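/- **Model.** In the vertex-arrival, vertex-adjacency model, the input is a finite simple graph, given as a set of items; an item is a vertex together with the complete set of its neighbors. A *priority algorithm with advice* receives all items one at a time. In each round it has a real-valued priority function on the universe of all items, and a remaining item of highest priority is revealed, ties being broken adversarially. Then the algorithm reads zero or more further bits of an infinite advice tape $a\in\{0,1\}^{\mathbb N}$ (sequentially, from left to right) and irrevocably accepts or rejects the vertex, depending only on the items received and the advice read so far. It *works in Model 2* if each priority function depends only on the items received and the decisions made so far. **The algorithm $\mathrm{ALG}$.** The *current degree* of an unprocessed vertex is the number of its unprocessed neighbors. Call $v$ *advised* if it was accepted because of an advice bit. The priorities, from highest to lowest, and the decisions are as follows. 0. Once a vertex has been processed under rule 6: a neighbor of the vertex processed last. It is accepted if the last decision was to reject or if its current degree is $0$; otherwise it is rejected. (So a cycle is followed, accepting every other vertex and also the last one.) 1. Vertices with a rejected neighbor; they are accepted. 2. Vertices of current degree $0$; they are rejected. 3. Vertices of current degree $1$; they are rejected. 4. Neighbors of an advised vertex $v$ such that $v$ has an accepted neighbor; they are rejected. 5. Vertices $w$ of current degree $3$. Let $c(w)$ be the maximum of $|N(w)\cap N(v)|$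 over all advised vertices $v$ ($0$ if there are none). Larger $c(w)$ has higher priority; among those with $c(w)=0$, vertices having a neighbor that is also a neighbor of some already processed vertex come first. If $c(w)\ge 2$, then $w$ is accepted without advice. Otherwise one advice bit is read: $w$ is accepted if it is $1$ and rejected if it is $0$. 6. Vertices of current degree $2$; they are rejected. **The oracle.** Whenever a bit is read for a vertex $w$, the oracle's bit is $1$ if every vertex cover that has minimum size among those consistent with all decisions made so far contains $w$, and $0$ otherwise. **Theorem.** The algorithm $\mathrm{ALG}$ works in Model 2. Moreover, for every simple graph $G$ with $n$ vertices and maximum degree at most $3$, and for every way of breaking ties among items of highest priority, there is an advice tape that agrees with the oracle on all bits that are read; and, on every such tape, the set of vertices accepted by $\mathrm{ALG}$ is a vertex cover of $G$ of minimum size, and $\mathrm{ALG}$ reads at most $\frac{15n}{46}$ bits of advice. -/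

import Mathlib

/-! ## Adaptive priority algorithms with an advice tape -/

/-- What an algorithm does on one input item: it either takes a decision, or reads the next bit of
the advice tape and continues according to that bit. -/
inductive AdviceTree (D : Type*) where
  | answer (d : D) : AdviceTree D
  | read (onZero onOne : AdviceTree D) : AdviceTree D

/-- Evaluate the tree on the tape `a`, when `s` is the prefix of the tape that has been read so far.
The result is the decision and the new prefix. -/
def AdviceTree.run {D : Type*} : AdviceTree D → (ℕ → Bool) → List Bool → D × List Bool
  | .answer d, _, s => (d, s)
  | .read t₀ t₁, a, s =>
      if a s.length = true then t₁.run a (s ++ [true]) else t₀.run a (s ++ [false])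

/-- An adaptive priority algorithm with advice, for items from the universe `U` and decisions
from `D`. A history lists the items received so far, each with the decision made on it,
*the most recent one first*; the list of bits is the advice read so far. (Past decisions are
themselves determined by the past items and the advice.) -/
structure PriorityAlgorithm (U D : Type*) where
  /-- the current priority function on the universe of items -/
  priority : List (U × D) → List Bool → U → ℝ
  /-- reading advice and deciding on the item that has just been received -/
  decision : List (U × D) → List Bool → U → AdviceTree D

namespace PriorityAlgorithm

variable {U D : Type*}

/-- Model 2: the priority functions depend only on the items received and the decisions made
so far, not otherwise on the advice. -/
def IsModel2 (A : PriorityAlgorithm U D) : Prop :=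
  ∀ (h : List (U × D)) (s s' : List Bool), A.priority h s = A.priority h s'

/-- `τ` is a tie-breaking rule for `A`: out of the nonempty multiset `R` of remaining items it
picks one of highest priority. Nothing else is required of it. -/
def IsTieBreaking (A : PriorityAlgorithm U D)
    (τ : List (U × D) → List Bool → Multiset U → U) : Prop :=
  ∀ (h : List (U × D)) (s : List Bool) (R : Multiset U), R ≠ 0 →
    τ h s R ∈ R ∧ ∀ y ∈ R, A.priority h s y ≤ A.priority h s (τ h s R)

/-- A configuration of a run. -/
structure Config (U D : Type*) where
  /-- the items that have not been received yet -/
  remaining : Multiset U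
  /-- the received items with their decisions, the most recent one first -/
  history : List (U × D)
  /-- the prefix of the advice tape that has been read -/
  advice : List Bool

/-- One round: the item picked by `τ` is received, advice is read, and a decision is made. -/
def step [DecidableEq U] (A : PriorityAlgorithm U D)
    (τ : List (U × D) → List Bool → Multiset U → U) (a : ℕ → Bool) (c : Config U D) :
    Config U D :=
  let x := τ c.history c.advice c.remaining
  let r := (A.decision c.history c.advice x).run a c.advice
  { remaining := c.remaining.erase x
    history := (x, r.1) :: c.history
    advice := r.2 }

/-- The configuration after `i` rounds on the input `X`, with tie-breaking `τ` and tape `a`. -/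
def configAfter [DecidableEq U] (A : PriorityAlgorithm U D)
    (τ : List (U × D) → List Bool → Multiset U → U) (a : ℕ → Bool) (X : Multiset U) :
    ℕ → Config U D
  | 0 => { remaining := X, history := [], advice := [] }
  | i + 1 => A.step τ a (A.configAfter τ a X i)

/-- The configuration when all items of `X` have been received. -/
def finalConfig [DecidableEq U] (A : PriorityAlgorithm U D)
    (τ : List (U × D) → List Bool → Multiset U → U) (a : ℕ → Bool) (X : Multiset U) :
    Config U D :=
  A.configAfter τ a X X.card

end PriorityAlgorithm

/-! ## Vertex cover in the vertex arrival, vertex adjacency model -/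

namespace VC

/-- An input item: a vertex together with the complete set of its neighbors. -/
abbrev Item (L : Type*) := L × Finset L

/-- Items with decisions (`true` is accept, `false` is reject), the most recent one first. -/
abbrev History (L : Type*) := List (Item L × Bool)

/-- The neighbors of `v` in the graph on the vertex set `W` whose adjacency is `G`. -/
noncomputable def nbrs {L : Type*} (W : Finset L) (G : SimpleGraph L) (v : L) : Finset L :=
  open Classical in W.filter (fun u => G.Adj v u)

/-- The input that presents the graph: one item for each vertex. -/
noncomputable def instanceOf {L : Type*} (W : Finset L) (G : SimpleGraph L) :
    Multiset (Item L) :=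
  W.val.map (fun v => (v, nbrs W G v))

/-- `T` is a vertex cover of the graph that agrees with all decisions in `h`. -/
def IsCoverExtending {L : Type*} (W : Finset L) (G : SimpleGraph L) (h : History L)
    (T : Finset L) : Prop :=
  T ⊆ W ∧ G.IsVertexCover (T : Set L) ∧ ∀ p ∈ h, (p.1.1 ∈ T ↔ p.2 = true)

/-- `T` has minimum size among the vertex covers that agree with all decisions in `h`. -/
def IsMinCoverExtending {L : Type*} (W : Finset L) (G : SimpleGraph L) (h : History L)
    (T : Finset L) : Prop :=
  IsCoverExtending W G h T ∧ ∀ T', IsCoverExtending W G h T' → T.card ≤ T'.card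

/-- `T` is a vertex cover of minimum size. -/
def IsMinVertexCover {L : Type*} (W : Finset L) (G : SimpleGraph L) (T : Finset L) : Prop :=
  (T ⊆ W ∧ G.IsVertexCover (T : Set L)) ∧
    ∀ T' : Finset L, T' ⊆ W → G.IsVertexCover (T' : Set L) → T.card ≤ T'.card

section Algorithm

variable {L : Type*} [DecidableEq L]

/-- The vertices processed so far. -/
def processed (h : History L) : Finset L := (h.map (fun p => p.1.1)).toFinset

/-- The vertices accepted so far. -/
def accepted (h : History L) : Finset L :=
  ((h.filter (fun p => p.2)).map (fun p => p.1.1)).toFinset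

/-- The vertices rejected so far. -/
def rejected (h : History L) : Finset L :=
  ((h.filter (fun p => !p.2)).map (fun p => p.1.1)).toFinset

/-- The vertices seen so far as a neighbor of a processed vertex. -/
def seen (h : History L) : Finset L := h.foldr (fun p s => p.1.2 ∪ s) ∅

/-- The current degree: processing a vertex decreases the degrees of its neighbors by one. -/
def curDeg (h : History L) (x : Item L) : ℕ := (x.2 \ processed h).card

/-- The largest number of neighbors that `x` has in common with one of the items in `A`. -/
def maxCommon (A : List (Item L)) (x : Item L) : ℕ :=
  A.foldr (fun v m => max (x.2 ∩ v.2).card m) 0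

/-- Is `x` a neighbor of the vertex processed last? -/
def adjLast (h : History L) (x : Item L) : Bool :=
  match h with
  | [] => false
  | p :: _ => decide (x.1 ∈ p.1.2)

/-- The reasons for which an item can be processed, in order of decreasing priority. -/
inductive Kind where
  /-- the cycles are being processed, and the item continues the current cycle -/
  | follow
  /-- it has a rejected neighbor -/
  | rejectedNbr
  /-- its current degree is zero -/
  | degZero
  /-- its current degree is one -/
  | degOne
  /-- it is a neighbor of a vertex with advice to accept which has an accepted neighbor -/
  | sibling
  /-- its current degree is three -/
  | degThree
  /-- everything else, that is, its current degree is two -/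
  | degTwo

/-- The kind of the item `x`, if `A` are the items for which there was advice to accept, and `cyc`
tells whether the processing of the cycles has begun. -/
def kindWith (A : List (Item L)) (cyc : Bool) (h : History L) (x : Item L) : Kind :=
  if cyc = true ∧ adjLast h x = true then .follow
  else if (x.2 ∩ rejected h).Nonempty then .rejectedNbr
  else if curDeg h x = 0 then .degZero
  else if curDeg h x = 1 then .degOne
  else if ∃ v ∈ A, x.1 ∈ v.2 ∧ (v.2 ∩ accepted h).Nonempty then .sibling
  else if curDeg h x = 3 then .degThree
  else .degTwo

/-- What the algorithm deduces from the items and the decisions so far: the items that were accepted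
because of an advice bit, and whether an item of kind `degTwo` has been processed. -/
def memory : History L → List (Item L) × Bool
  | [] => ([], false)
  | (x, d) :: h =>
      let m := memory h
      match kindWith m.1 m.2 h x with
      | .degThree => if d = true ∧ maxCommon m.1 x < 2 then (x :: m.1, m.2) else m
      | .degTwo => (m.1, true)
      | _ => m

/-- The kind of the item `x` after the history `h`. -/
def kind (h : History L) (x : Item L) : Kind := kindWith (memory h).1 (memory h).2 h x

/-- The priorities. Among the items of current degree three, those with more neighbors in common
with a vertex for which there was advice to accept come first; next come those with a neighbor
that has been seen before. -/
def priorityValue (h : History L) (x : Item L) : ℕ :=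
  match kind h x with
  | .follow => 20
  | .rejectedNbr => 19
  | .degZero => 18
  | .degOne => 17
  | .sibling => 16
  | .degThree =>
      if 0 < maxCommon (memory h).1 x then 2 + maxCommon (memory h).1 x
      else if (x.2 ∩ seen h).Nonempty then 2
      else 1
  | .degTwo => 0

/-- The last decision in `h` was to reject. -/
def lastRejected (h : History L) : Bool :=
  match h with
  | [] => false
  | p :: _ => !p.2

/-- An advice bit is needed for an item of current degree three, unless it has two neighbors in
common with a vertex for which there was advice to accept. -/
def NeedsAdvice (h : History L) (x : Item L) : Prop :=
  kind h x = .degThree ∧ maxCommon (memory h).1 x < 2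

/-- The decisions. Along a cycle every other vertex is accepted, beginning with a rejected one, and
the last one, of current degree zero, is accepted. -/
def decideItem (h : History L) (x : Item L) : AdviceTree Bool :=
  match kind h x with
  | .follow => .answer (lastRejected h || decide (curDeg h x = 0))
  | .rejectedNbr => .answer true
  | .degZero => .answer false
  | .degOne => .answer false
  | .sibling => .answer false
  | .degThree =>
      if 2 ≤ maxCommon (memory h).1 x then .answer true
      else .read (.answer false) (.answer true)
  | .degTwo => .answer false

end Algorithm

/-- The algorithm for minimum vertex cover on graphs of maximum degree three, over an arbitrary
type `L` of vertex labels. -/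
noncomputable def ALG (L : Type*) [DecidableEq L] : PriorityAlgorithm (Item L) Bool where
  priority h _ x := (priorityValue h x : ℝ)
  decision h _ x := decideItem h x

/-- The tape `a` is the advice of the oracle: whenever a bit is read for a vertex, that bit is `1`
(accept) if all minimum-size vertex covers that agree with the decisions made so far contain the
vertex, and `0` (reject) otherwise. Bits that are not read are arbitrary. -/
def IsOracleTape {L : Type*} [DecidableEq L] (W : Finset L) (G : SimpleGraph L)
    (τ : History L → List Bool → Multiset (Item L) → Item L) (a : ℕ → Bool) : Prop :=
  ∀ i < W.card,
    let c := (ALG L).configAfter τ a (instanceOf W G) i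
    let x := τ c.history c.advice c.remaining
    NeedsAdvice c.history x →
      (a c.advice.length = true ↔ ∀ T, IsMinCoverExtending W G c.history T → x.1 ∈ T)

end VC

set_option linter.unusedSectionVars false

namespace VC

/-! ### Histories -/

section History

variable {L : Type*} [DecidableEq L]

/-! Optimality. As long as no cycle has been started, some minimum vertex cover agrees with all
decisions (`OptExt`), so the covers that the oracle ranges over are exactly the minimum covers that
agree with the history. The basic exchange (`OptExt.exists_avoiding`) removes a vertex from a cover
and inserts its only uncovered neighbor; it justifies rejecting vertices of current degree at most
one. It also shows that, if the oracle says that `v` is in every such cover, then none of them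
contains two of the three neighbors of `v`, as otherwise `v` could be exchanged. This property
(`AdvInv`) justifies rule 4 and the acceptance without advice in rule 5. When rule 6 first applies,
all unprocessed vertices have current degree two and no rejected neighbor, so disjoint cycles
remain. Accepting half of each cycle, rounded up, is optimal, because a cover contains at least half
of the vertices of a cycle.

Number of bits. An unprocessed vertex weighs 15 as long as none of its neighbors has been processed,
and 8 afterwards; the initial weight is 15 per vertex. Two histories are compared that are quiet,
meaning that no rule of priority higher than rule 5 applies. Between them one vertex `w` of current
degree three is processed, followed by forced vertices. It is to be shown that each bit is
accompanied by a loss of weight of at least 46. If `w` is rejected, its neighbors are forced. If `w`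
is accepted and has a neighbor `a` of degree two, then `a` and its other neighbor are forced. Both
cases yield 46 (`Shrink.gain_closed`, `Shrink.gain_path`).

The exception is an accepted `w` all of whose neighbors have degree three: nothing is forced, and
the loss is only 15 + 3 · 7 = 36. A debt of 10 arises. It is backed by the three neighbors of `w`:
if the next vertex of degree three that needs advice has no seen neighbor, then by the priorities no
vertex of degree three has one, and all seen vertices can be marked, that is, lowered to weight 4.
This releases 3 · 4 = 12 and cancels the debt. If the next vertex has a seen neighbor, then it has
exactly one, since `c(w) < 2`. The extra unseen neighbors then repay the debt at once, or reduce it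
to 3 with two backing vertices left (`Segment.account_of_debt`). -/

@[simp] theorem processed_nil : processed ([] : History L) = ∅ := rfl
@[simp] theorem accepted_nil : accepted ([] : History L) = ∅ := rfl
@[simp] theorem rejected_nil : rejected ([] : History L) = ∅ := rfl
@[simp] theorem seen_nil : seen ([] : History L) = ∅ := rfl

@[simp] theorem processed_cons (p : Item L × Bool) (h : History L) :
    processed (p :: h) = insert p.1.1 (processed h) := by
  simp [processed]

@[simp] theorem accepted_cons_true (x : Item L) (h : History L) :
    accepted ((x, true) :: h) = insert x.1 (accepted h) := by
  simp [accepted]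

@[simp] theorem accepted_cons_false (x : Item L) (h : History L) :
    accepted ((x, false) :: h) = accepted h := by
  simp [accepted]

@[simp] theorem rejected_cons_true (x : Item L) (h : History L) :
    rejected ((x, true) :: h) = rejected h := by
  simp [rejected]

@[simp] theorem rejected_cons_false (x : Item L) (h : History L) :
    rejected ((x, false) :: h) = insert x.1 (rejected h) := by
  simp [rejected]

@[simp] theorem seen_cons (p : Item L × Bool) (h : History L) :
    seen (p :: h) = p.1.2 ∪ seen h := rfl

theorem mem_processed {h : History L} {v : L} : v ∈ processed h ↔ ∃ p ∈ h, p.1.1 = v := by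
  simp [processed]

theorem mem_accepted {h : History L} {v : L} :
    v ∈ accepted h ↔ ∃ p ∈ h, p.1.1 = v ∧ p.2 = true := by
  simp only [accepted, List.mem_toFinset, List.mem_map, List.mem_filter]
  exact ⟨fun ⟨p, ⟨h1, h2⟩, h3⟩ => ⟨p, h1, h3, h2⟩, fun ⟨p, h1, h3, h2⟩ => ⟨p, ⟨h1, h2⟩, h3⟩⟩

theorem mem_rejected {h : History L} {v : L} :
    v ∈ rejected h ↔ ∃ p ∈ h, p.1.1 = v ∧ p.2 = false := by
  simp only [rejected, List.mem_toFinset, List.mem_map, List.mem_filter, Bool.not_eq_true']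
  exact ⟨fun ⟨p, ⟨h1, h2⟩, h3⟩ => ⟨p, h1, h3, h2⟩, fun ⟨p, h1, h3, h2⟩ => ⟨p, ⟨h1, h2⟩, h3⟩⟩

theorem mem_seen {h : History L} {v : L} : v ∈ seen h ↔ ∃ p ∈ h, v ∈ p.1.2 := by
  induction h with
  | nil => simp
  | cons p h ih => simp [ih]

theorem processed_eq (h : History L) : processed h = accepted h ∪ rejected h := by
  ext v
  simp only [Finset.mem_union, mem_processed, mem_accepted, mem_rejected]
  constructor
  · rintro ⟨p, hp, rfl⟩
    cases hd : p.2
    · exact Or.inr ⟨p, hp, rfl, hd⟩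
    · exact Or.inl ⟨p, hp, rfl, hd⟩
  · rintro (⟨p, hp, rfl, -⟩ | ⟨p, hp, rfl, -⟩) <;> exact ⟨p, hp, rfl⟩

theorem accepted_subset_processed (h : History L) : accepted h ⊆ processed h := by
  rw [processed_eq]; exact Finset.subset_union_left

theorem rejected_subset_processed (h : History L) : rejected h ⊆ processed h := by
  rw [processed_eq]; exact Finset.subset_union_right

theorem le_maxCommon {A : List (Item L)} {v : Item L} (hv : v ∈ A) (x : Item L) :
    (x.2 ∩ v.2).card ≤ maxCommon A x := by
  induction A with
  | nil => simp at hv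
  | cons a A ih =>
    rcases List.mem_cons.1 hv with rfl | hv
    · exact le_max_left _ _
    · exact (ih hv).trans (le_max_right _ _)

theorem exists_maxCommon {A : List (Item L)} {x : Item L} (h : 0 < maxCommon A x) :
    ∃ v ∈ A, (x.2 ∩ v.2).card = maxCommon A x := by
  induction A with
  | nil => simp [maxCommon] at h
  | cons a A ih =>
    have e : maxCommon (a :: A) x = max (x.2 ∩ a.2).card (maxCommon A x) := rfl
    rcases le_total (maxCommon A x) (x.2 ∩ a.2).card with hle | hle
    · exact ⟨a, by simp, by rw [e, max_eq_left hle]⟩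
    · rw [e, max_eq_right hle] at h
      obtain ⟨v, hv, hv'⟩ := ih h
      exact ⟨v, by simp [hv], by rw [e, max_eq_right hle, hv']⟩

theorem maxCommon_le (A : List (Item L)) (x : Item L) : maxCommon A x ≤ x.2.card := by
  rcases Nat.eq_zero_or_pos (maxCommon A x) with h | h
  · omega
  · obtain ⟨v, -, hv⟩ := exists_maxCommon h
    rw [← hv]
    exact Finset.card_le_card Finset.inter_subset_left

/-- The advised items stem from the history. -/
theorem mem_of_mem_memory {h : History L} {x : Item L} (hx : x ∈ (memory h).1) :
    (x, true) ∈ h := by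
  induction h with
  | nil => simp [memory] at hx
  | cons p h ih =>
    obtain ⟨y, d⟩ := p
    simp only [memory] at hx
    split at hx
    · split_ifs at hx with hc
      · rcases List.mem_cons.1 hx with rfl | hx
        · simp [hc.1]
        · exact List.mem_cons_of_mem _ (ih hx)
      · exact List.mem_cons_of_mem _ (ih hx)
    · exact List.mem_cons_of_mem _ (ih hx)
    · exact List.mem_cons_of_mem _ (ih hx)

/-- Advised items are never forgotten, so rule 4 and a debt may refer to them later. -/
theorem memory_fst_subset_cons (p : Item L × Bool) (h : History L) :
    (memory h).1 ⊆ (memory (p :: h)).1 := by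
  obtain ⟨x, d⟩ := p
  simp only [memory]
  split
  · split_ifs
    · exact List.subset_cons_self _ _
    · exact List.Subset.refl _
  · exact List.Subset.refl _
  · exact List.Subset.refl _

theorem memory_snd_cons {x : Item L} {d : Bool} {h : History L} (hk : kind h x ≠ .degTwo) :
    (memory ((x, d) :: h)).2 = (memory h).2 := by
  unfold kind at hk
  simp only [memory]
  split
  · split_ifs <;> rfl
  · contradiction
  · rfl

theorem memory_snd_cons_degTwo {x : Item L} {d : Bool} {h : History L} (hk : kind h x = .degTwo) :
    (memory ((x, d) :: h)).2 = true := by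
  unfold kind at hk
  simp only [memory, hk]

theorem memory_snd_cons_of_true {x : Item L} {d : Bool} {h : History L}
    (hm : (memory h).2 = true) : (memory ((x, d) :: h)).2 = true := by
  by_cases hk : kind h x = .degTwo
  · exact memory_snd_cons_degTwo hk
  · rw [memory_snd_cons hk, hm]

theorem memory_fst_cons_of_ne {x : Item L} {d : Bool} {h : History L}
    (hk : kind h x ≠ .degThree) : (memory ((x, d) :: h)).1 = (memory h).1 := by
  unfold kind at hk
  simp only [memory]
  split
  · contradiction
  · rfl
  · rfl

theorem memory_fst_cons_degThree {x : Item L} {d : Bool} {h : History L}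
    (hk : kind h x = .degThree) : (memory ((x, d) :: h)).1 =
      if d = true ∧ maxCommon (memory h).1 x < 2 then x :: (memory h).1 else (memory h).1 := by
  unfold kind at hk
  simp only [memory, hk]
  split_ifs <;> rfl

end History

/-! ### Runs with the oracle -/

section Runs

variable {L : Type*} [DecidableEq L]

/-- The item that presents the vertex `v`. -/
noncomputable abbrev item (W : Finset L) (G : SimpleGraph L) (v : L) : Item L := (v, nbrs W G v)

/-- The unprocessed vertices. -/
abbrev unproc (W : Finset L) (h : History L) : Finset L := W \ processed h

/-- Vertex `v` can be received next. -/
def IsTop (W : Finset L) (G : SimpleGraph L) (h : History L) (v : L) : Prop :=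
  v ∈ unproc W h ∧
    ∀ y ∈ unproc W h, priorityValue h (item W G y) ≤ priorityValue h (item W G v)

/-- The histories of runs with the advice of the oracle, with the number of bits read. -/
inductive Reach (W : Finset L) (G : SimpleGraph L) : History L → ℕ → Prop
  | nil : Reach W G [] 0
  | advised {h : History L} {b : ℕ} {v : L} {d : Bool} (hr : Reach W G h b) (ht : IsTop W G h v)
      (hn : NeedsAdvice h (item W G v))
      (hd : d = true ↔ ∀ T, IsMinCoverExtending W G h T → v ∈ T) :
      Reach W G ((item W G v, d) :: h) (b + 1)
  | unadvised {h : History L} {b : ℕ} {v : L} {d : Bool} (hr : Reach W G h b) (ht : IsTop W G h v)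
      (hn : ¬ NeedsAdvice h (item W G v)) (hd : decideItem h (item W G v) = .answer d) :
      Reach W G ((item W G v, d) :: h) b

theorem decideItem_of_needsAdvice {h : History L} {x : Item L} (hn : NeedsAdvice h x) :
    decideItem h x = .read (.answer false) (.answer true) := by
  have := hn.2
  simp only [decideItem, hn.1]
  rw [if_neg (by omega)]

theorem decideItem_of_not_needsAdvice {h : History L} {x : Item L} (hn : ¬ NeedsAdvice h x) :
    ∃ d, decideItem h x = .answer d := by
  unfold decideItem
  cases hk : kind h x <;> simp only [] <;> try exact ⟨_, rfl⟩
  rw [if_pos]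
  · exact ⟨_, rfl⟩
  · by_contra hc
    exact hn ⟨hk, by omega⟩

variable {W : Finset L} {G : SimpleGraph L}
  {τ : History L → List Bool → Multiset (Item L) → Item L}

theorem instanceOf_erase {s : Finset L} {v : L} :
    (s.val.map (item W G)).erase (item W G v) = (s.erase v).val.map (item W G) := by
  rw [Finset.erase_val, Multiset.map_erase]
  intro a b hab
  exact congrArg Prod.fst hab

/-- The state of a run after `i` rounds. -/
theorem configAfter_spec (hτ : (ALG L).IsTieBreaking τ) {a : ℕ → Bool} {n : ℕ}
    (ha : ∀ i < n,
      let c := (ALG L).configAfter τ a (instanceOf W G) i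
      let x := τ c.history c.advice c.remaining
      NeedsAdvice c.history x →
        (a c.advice.length = true ↔ ∀ T, IsMinCoverExtending W G c.history T → x.1 ∈ T))
    (hn : n ≤ W.card) :
    let c := (ALG L).configAfter τ a (instanceOf W G) n
    Reach W G c.history c.advice.length ∧ (unproc W c.history).card + n = W.card ∧
      c.remaining = (unproc W c.history).val.map (item W G) := by
  induction n with
  | zero =>
    refine ⟨Reach.nil, ?_, ?_⟩
    · simp [PriorityAlgorithm.configAfter, unproc]
    · simp [PriorityAlgorithm.configAfter, instanceOf]
  | succ n ih =>
    obtain ⟨h1, h2, h3⟩ := ih (fun i hi => ha i (by omega)) (by omega)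
    have hb := ha n (by omega)
    simp only [PriorityAlgorithm.configAfter, PriorityAlgorithm.step]
    set c := (ALG L).configAfter τ a (instanceOf W G) n with hc
    have hne : c.remaining ≠ 0 := by
      rw [h3]
      intro h0
      have := congrArg Multiset.card h0
      simp only [Multiset.card_map, Finset.card_val, Multiset.card_zero] at this
      omega
    obtain ⟨hx, hmax⟩ := hτ c.history c.advice c.remaining hne
    set x := τ c.history c.advice c.remaining with hxdef
    rw [h3, Multiset.mem_map] at hx
    obtain ⟨v, hv, hvx⟩ := hx
    have hv' : v ∈ unproc W c.history := hv
    have htop : IsTop W G c.history v := by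
      refine ⟨hv', fun y hy => ?_⟩
      have := hmax (item W G y) (by rw [h3]; exact Multiset.mem_map_of_mem _ hy)
      rw [← hvx] at this
      simpa [ALG] using this
    have hun : ∀ d : Bool, unproc W ((item W G v, d) :: c.history) =
        (unproc W c.history).erase v := by
      intro d
      ext y
      simp only [unproc, processed_cons, Finset.mem_sdiff, Finset.mem_insert, Finset.mem_erase]
      tauto
    have hcard := Finset.card_erase_of_mem hv'
    have hpos := Finset.card_pos.2 ⟨v, hv'⟩
    change NeedsAdvice c.history x → (a c.advice.length = true ↔
      ∀ T, IsMinCoverExtending W G c.history T → x.1 ∈ T) at hb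
    rw [← hvx] at hb ⊢
    have hdec : ((ALG L).decision c.history c.advice (item W G v)) =
        decideItem c.history (item W G v) := rfl
    rw [hdec]
    by_cases hna : NeedsAdvice c.history (item W G v)
    · rw [decideItem_of_needsAdvice hna]
      have hb' := hb hna
      have hrun : (AdviceTree.run (.read (.answer false) (.answer true)) a c.advice) =
          (a c.advice.length, c.advice ++ [a c.advice.length]) := by
        cases hh : a c.advice.length <;> simp [AdviceTree.run, hh]
      rw [hrun]
      refine ⟨?_, ?_, ?_⟩
      · simp only [List.length_append, List.length_singleton]
        exact Reach.advised h1 htop hna hb'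
      · simp only [hun]; omega
      · simp only [hun]; rw [h3, instanceOf_erase]
    · obtain ⟨d, hd⟩ := decideItem_of_not_needsAdvice hna
      rw [hd]
      refine ⟨?_, ?_, ?_⟩
      · exact Reach.unadvised h1 htop hna hd
      · simp only [AdviceTree.run, hun]; omega
      · simp only [AdviceTree.run, hun]; rw [h3, instanceOf_erase]

theorem finalConfig_spec (hτ : (ALG L).IsTieBreaking τ) {a : ℕ → Bool}
    (ha : IsOracleTape W G τ a) :
    let c := (ALG L).finalConfig τ a (instanceOf W G)
    Reach W G c.history c.advice.length ∧ W ⊆ processed c.history := by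
  have hcard : (instanceOf W G).card = W.card := by simp [instanceOf]
  have := configAfter_spec hτ (n := W.card) ha le_rfl
  simp only [PriorityAlgorithm.finalConfig, hcard]
  refine ⟨this.1, ?_⟩
  have h2 := this.2.1
  dsimp only [unproc] at h2
  rw [← Finset.sdiff_eq_empty_iff_subset, ← Finset.card_eq_zero]
  omega

/-! ### Existence of a tape that agrees with the oracle -/

/-- A position of the tape is consulted only when its bit is appended to the prefix. The bound on
lengths is proved along with the equation, because the induction needs that the position being read
lies within the final prefix. -/
theorem AdviceTree.run_congr {D : Type*} (t : AdviceTree D) {a a' : ℕ → Bool} {s : List Bool}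
    (h : ∀ j < (t.run a s).2.length, a j = a' j) :
    t.run a' s = t.run a s ∧ s.length ≤ (t.run a s).2.length := by
  induction t generalizing s with
  | answer d => exact ⟨rfl, le_rfl⟩
  | read t₀ t₁ ih₀ ih₁ =>
    cases hs : a s.length
    · have e : (AdviceTree.read t₀ t₁).run a s = t₀.run a (s ++ [false]) := by
        simp [AdviceTree.run, hs]
      rw [e] at h ⊢
      obtain ⟨h1, h2⟩ := ih₀ h
      simp only [List.length_append, List.length_singleton] at h2
      refine ⟨?_, by omega⟩
      have := h s.length (by omega)
      rw [← h1]
      simp [AdviceTree.run, ← this, hs]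
    · have e : (AdviceTree.read t₀ t₁).run a s = t₁.run a (s ++ [true]) := by
        simp [AdviceTree.run, hs]
      rw [e] at h ⊢
      obtain ⟨h1, h2⟩ := ih₁ h
      simp only [List.length_append, List.length_singleton] at h2
      refine ⟨?_, by omega⟩
      have := h s.length (by omega)
      rw [← h1]
      simp [AdviceTree.run, ← this, hs]

theorem AdviceTree.length_le_run {D : Type*} (t : AdviceTree D) (a : ℕ → Bool) (s : List Bool) :
    s.length ≤ (t.run a s).2.length :=
  (AdviceTree.run_congr t (a' := a) (fun _ _ => rfl)).2

theorem configAfter_advice_mono {U D : Type*} [DecidableEq U] (A : PriorityAlgorithm U D)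
    (τ : List (U × D) → List Bool → Multiset U → U) (a : ℕ → Bool) (X : Multiset U) :
    Monotone fun i => (A.configAfter τ a X i).advice.length :=
  monotone_nat_of_le_succ fun _ => AdviceTree.length_le_run _ _ _

/-- A configuration depends only on the part of the tape that has been read. -/
theorem configAfter_congr {U D : Type*} [DecidableEq U] (A : PriorityAlgorithm U D)
    (τ : List (U × D) → List Bool → Multiset U → U) {a a' : ℕ → Bool} (X : Multiset U) {n : ℕ}
    (h : ∀ j < (A.configAfter τ a X n).advice.length, a j = a' j) {i : ℕ} (hi : i ≤ n) :
    A.configAfter τ a' X i = A.configAfter τ a X i := by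
  induction i with
  | zero => rfl
  | succ i ih =>
    have hm := configAfter_advice_mono A τ a X hi
    simp only [PriorityAlgorithm.configAfter] at hm ⊢
    rw [ih (by omega)]
    simp only [PriorityAlgorithm.step] at hm ⊢
    rw [(AdviceTree.run_congr _ (fun j hj => h j (lt_of_lt_of_le hj hm))).1]

/-- The oracle's bit depends on the run so far, and the run so far depends only on the bits already
read. Hence the tape can be built round by round. -/
theorem exists_isOracleTape (W : Finset L) (G : SimpleGraph L)
    (τ : History L → List Bool → Multiset (Item L) → Item L) : ∃ a, IsOracleTape W G τ a := by
  classical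
  suffices H : ∀ n, ∃ a : ℕ → Bool, ∀ i < n,
      let c := (ALG L).configAfter τ a (instanceOf W G) i
      let x := τ c.history c.advice c.remaining
      NeedsAdvice c.history x →
        (a c.advice.length = true ↔ ∀ T, IsMinCoverExtending W G c.history T → x.1 ∈ T) from
    H W.card
  intro n
  induction n with
  | zero => exact ⟨fun _ => false, by simp⟩
  | succ n ih =>
    obtain ⟨a, ha⟩ := ih
    set c := (ALG L).configAfter τ a (instanceOf W G) n with hc
    let bit : Bool := decide (∀ T, IsMinCoverExtending W G c.history T →
      (τ c.history c.advice c.remaining).1 ∈ T)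
    -- Only the position of the next unread bit is overwritten; if the round reads no bit, this does
    -- no harm.
    let a' : ℕ → Bool := fun j => if j = c.advice.length then bit else a j
    have hcongr : ∀ i ≤ n, (ALG L).configAfter τ a' (instanceOf W G) i =
        (ALG L).configAfter τ a (instanceOf W G) i := fun i hi =>
      configAfter_congr (ALG L) τ (a' := a') (instanceOf W G) (n := n)
        (fun j hj => by simp only [a']; rw [if_neg (by rw [← hc] at hj; omega)]) hi
    refine ⟨a', fun i hi => ?_⟩
    rw [hcongr i (by omega)]
    rcases Nat.lt_succ_iff_lt_or_eq.1 hi with hi | rfl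
    · intro c' x hna
      -- A bit is read in round `i`, so its position precedes the overwritten one.
      have hlt : c'.advice.length < c.advice.length := by
        have hm := configAfter_advice_mono (ALG L) τ a (instanceOf W G) (Nat.succ_le_of_lt hi)
        refine lt_of_lt_of_le ?_ hm
        have e : ((ALG L).configAfter τ a (instanceOf W G) (i + 1)).advice =
          ((decideItem c'.history x).run a c'.advice).2 := rfl
        simp only [Nat.succ_eq_add_one, e, decideItem_of_needsAdvice hna]
        cases hh : a c'.advice.length <;> simp [AdviceTree.run, hh]
      have : a' c'.advice.length = a c'.advice.length := by
        simp only [a']; rw [if_neg (by omega)]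
      rw [this]
      exact ha i hi hna
    · intro c' x hna
      simp only [a', bit, c', x, ← hc, if_true, decide_eq_true_eq]

end Runs

/-! ### Kinds and priorities -/

section Kinds

variable {L : Type*} [DecidableEq L] {W : Finset L} {G : SimpleGraph L} {h : History L}
  {b : ℕ} {v w : L}

theorem mem_nbrs (hG : ∀ u v, G.Adj u v → u ∈ W ∧ v ∈ W) {u v : L} :
    u ∈ nbrs W G v ↔ G.Adj v u := by
  simp only [nbrs, Finset.mem_filter]
  exact ⟨fun h => h.2, fun h => ⟨(hG _ _ h).2, h⟩⟩

theorem mem_nbrs_comm (hG : ∀ u v, G.Adj u v → u ∈ W ∧ v ∈ W) {u v : L} :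
    u ∈ nbrs W G v ↔ v ∈ nbrs W G u := by
  rw [mem_nbrs hG, mem_nbrs hG, G.adj_comm]

theorem nbrs_subset (W : Finset L) (G : SimpleGraph L) (v : L) : nbrs W G v ⊆ W := by
  classical exact Finset.filter_subset _ _

theorem notMem_nbrs_self (hG : ∀ u v, G.Adj u v → u ∈ W ∧ v ∈ W) : v ∉ nbrs W G v := by
  rw [mem_nbrs hG]; exact G.irrefl

/-- Vertex `v` has a rejected neighbor. -/
def HasRej (W : Finset L) (G : SimpleGraph L) (h : History L) (v : L) : Prop :=
  (nbrs W G v ∩ rejected h).Nonempty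

/-- Vertex `v` is a neighbor of an advised vertex that has an accepted neighbor. -/
def IsSibling (h : History L) (v : L) : Prop :=
  ∃ p ∈ (memory h).1, v ∈ p.2 ∧ (p.2 ∩ accepted h).Nonempty

/-- No unprocessed vertex is of one of the kinds of high priority. -/
def Quiet (W : Finset L) (G : SimpleGraph L) (h : History L) : Prop :=
  ∀ v ∈ unproc W h, ¬ HasRej W G h v ∧ 2 ≤ curDeg h (item W G v) ∧ ¬ IsSibling h v

theorem Reach.items (hr : Reach W G h b) : ∀ p ∈ h, p.1 = item W G p.1.1 ∧ p.1.1 ∈ W := by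
  induction hr with
  | nil => simp
  | advised hr ht hn hd ih =>
    intro p hp
    rcases List.mem_cons.1 hp with rfl | hp
    · exact ⟨rfl, (Finset.mem_sdiff.1 ht.1).1⟩
    · exact ih p hp
  | unadvised hr ht hn hd ih =>
    intro p hp
    rcases List.mem_cons.1 hp with rfl | hp
    · exact ⟨rfl, (Finset.mem_sdiff.1 ht.1).1⟩
    · exact ih p hp

theorem Reach.processed_subset (hr : Reach W G h b) : processed h ⊆ W := by
  intro v hv
  obtain ⟨p, hp, rfl⟩ := mem_processed.1 hv
  exact (hr.items p hp).2

/-- By symmetry of adjacency, being seen means having lost a neighbor. This ties the weights to the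
current degrees. -/
theorem Reach.mem_seen_iff (hG : ∀ u v, G.Adj u v → u ∈ W ∧ v ∈ W) (hr : Reach W G h b) :
    v ∈ seen h ↔ (nbrs W G v ∩ processed h).Nonempty := by
  rw [mem_seen]
  constructor
  · rintro ⟨p, hp, hv⟩
    refine ⟨p.1.1, Finset.mem_inter.2 ⟨?_, mem_processed.2 ⟨p, hp, rfl⟩⟩⟩
    rw [(hr.items p hp).1] at hv
    exact (mem_nbrs_comm hG).1 hv
  · rintro ⟨u, hu⟩
    obtain ⟨hu, hup⟩ := Finset.mem_inter.1 hu
    obtain ⟨p, hp, rfl⟩ := mem_processed.1 hup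
    refine ⟨p, hp, ?_⟩
    rw [(hr.items p hp).1]
    exact (mem_nbrs_comm hG).1 hu

theorem kind_pre (hm : (memory h).2 = false) (x : Item L) :
    kind h x = if (x.2 ∩ rejected h).Nonempty then .rejectedNbr
      else if curDeg h x = 0 then .degZero
      else if curDeg h x = 1 then .degOne
      else if ∃ v ∈ (memory h).1, x.1 ∈ v.2 ∧ (v.2 ∩ accepted h).Nonempty then .sibling
      else if curDeg h x = 3 then .degThree
      else .degTwo := by
  simp [kind, kindWith, hm]

theorem curDeg_le (hdeg : ∀ v ∈ W, (nbrs W G v).card ≤ 3) (hv : v ∈ W) :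
    curDeg h (item W G v) ≤ 3 :=
  (Finset.card_le_card Finset.sdiff_subset).trans (hdeg v hv)

/-- The degree is at most three, so current degree three leaves no room for a processed neighbor. -/
theorem nbrs_of_curDeg_eq_three (hdeg : ∀ v ∈ W, (nbrs W G v).card ≤ 3) (hv : v ∈ W)
    (h3 : curDeg h (item W G v) = 3) :
    Disjoint (nbrs W G v) (processed h) ∧ (nbrs W G v).card = 3 := by
  have h1 := hdeg v hv
  have h2 : (nbrs W G v \ processed h).card = 3 := h3
  have h4 := Finset.card_le_card (Finset.sdiff_subset (s := nbrs W G v) (t := processed h))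
  refine ⟨?_, by omega⟩
  rw [← Finset.sdiff_eq_self_iff_disjoint]
  exact Finset.eq_of_subset_of_card_le Finset.sdiff_subset (by omega)

theorem priorityValue_degThree {x : Item L} (hk : kind h x = .degThree) :
    priorityValue h x = if 0 < maxCommon (memory h).1 x then 2 + maxCommon (memory h).1 x
      else if (x.2 ∩ seen h).Nonempty then 2 else 1 := by
  simp only [priorityValue, hk]

/-- The constant is 2 + 3, as at most three neighbors can be shared; it lies below the values of all
forced kinds. -/
theorem priorityValue_low (hdeg : ∀ v ∈ W, (nbrs W G v).card ≤ 3) (hv : v ∈ W)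
    (hk : kind h (item W G v) = .degThree ∨ kind h (item W G v) = .degTwo) :
    priorityValue h (item W G v) ≤ 5 := by
  have h1 := (maxCommon_le (memory h).1 (item W G v)).trans (hdeg v hv)
  rcases hk with hk | hk
  · rw [priorityValue_degThree hk]
    split_ifs <;> omega
  · simp [priorityValue, hk]

theorem kind_of_priorityValue {x : Item L} (hp : priorityValue h x ≤ 5) :
    kind h x = .degThree ∨ kind h x = .degTwo := by
  unfold priorityValue at hp
  cases hk : kind h x <;> simp [hk] at hp ⊢

theorem IsTop.kind_low (hdeg : ∀ v ∈ W, (nbrs W G v).card ≤ 3) (ht : IsTop W G h v)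
    (hk : kind h (item W G v) = .degThree ∨ kind h (item W G v) = .degTwo) :
    ∀ y ∈ unproc W h, kind h (item W G y) = .degThree ∨ kind h (item W G y) = .degTwo :=
  fun y hy => kind_of_priorityValue ((ht.2 y hy).trans
    (priorityValue_low hdeg (Finset.mem_sdiff.1 ht.1).1 hk))

theorem IsTop.kind_degTwo (ht : IsTop W G h v)
    (hk : kind h (item W G v) = .degTwo) :
    ∀ y ∈ unproc W h, kind h (item W G y) = .degTwo := by
  intro y hy
  have h1 := ht.2 y hy
  have h2 : priorityValue h (item W G v) = 0 := by simp [priorityValue, hk]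
  rcases kind_of_priorityValue (h := h) (x := item W G y) (by omega) with h3 | h3
  · rw [priorityValue_degThree h3] at h1
    split_ifs at h1 <;> omega
  · exact h3

theorem kind_pre_low (hm : (memory h).2 = false)
    (hk : kind h (item W G v) = .degThree ∨ kind h (item W G v) = .degTwo) :
    ¬ HasRej W G h v ∧ 2 ≤ curDeg h (item W G v) ∧ ¬ IsSibling h v := by
  rw [kind_pre hm] at hk
  split_ifs at hk with h1 h2 h3 h4 h5
  all_goals simp at hk
  · exact ⟨h1, by omega, h4⟩
  · exact ⟨h1, by omega, h4⟩

/-- A vertex of one of the two lowest kinds is received only when no forced vertex is left. -/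
theorem IsTop.quiet (hdeg : ∀ v ∈ W, (nbrs W G v).card ≤ 3) (hm : (memory h).2 = false)
    (ht : IsTop W G h v)
    (hk : kind h (item W G v) = .degThree ∨ kind h (item W G v) = .degTwo) :
    Quiet W G h :=
  fun y hy => kind_pre_low hm (ht.kind_low hdeg hk y hy)

theorem Quiet.kind_low (hq : Quiet W G h) (hm : (memory h).2 = false) (hv : v ∈ unproc W h) :
    kind h (item W G v) = .degThree ∨ kind h (item W G v) = .degTwo := by
  obtain ⟨h1, h2, h3⟩ := hq v hv
  rw [kind_pre hm]
  split_ifs with a b c d e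
  exacts [absurd a h1, by omega, by omega, absurd d h3, Or.inl rfl, Or.inr rfl]

theorem Quiet.kind_degThree (hq : Quiet W G h) (hm : (memory h).2 = false) (hv : v ∈ unproc W h)
    (h3 : curDeg h (item W G v) = 3) : kind h (item W G v) = .degThree := by
  obtain ⟨h1, h2, h4⟩ := hq v hv
  rw [kind_pre hm]
  split_ifs with a b c d
  exacts [absurd a h1, by omega, by omega, absurd d h4, rfl]

theorem curDeg_of_kind_degThree {x : Item L} (hk : kind h x = .degThree) : curDeg h x = 3 := by
  unfold kind kindWith at hk
  split_ifs at hk with h1 h2 h3 h4 h5 h6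
  exact h6

end Kinds

/-! ### Local optimality arguments -/

section Local

variable {L : Type*} [DecidableEq L] {W : Finset L} {G : SimpleGraph L} {h : History L}
  {b : ℕ} {v w : L} {T : Finset L}

/-- `T` is a minimum vertex cover that agrees with the decisions in `h`. -/
def OptExt (W : Finset L) (G : SimpleGraph L) (h : History L) (T : Finset L) : Prop :=
  IsMinVertexCover W G T ∧ ∀ p ∈ h, (p.1.1 ∈ T ↔ p.2 = true)

theorem optExt_cons {p : Item L × Bool} :
    OptExt W G (p :: h) T ↔ OptExt W G h T ∧ (p.1.1 ∈ T ↔ p.2 = true) := by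
  simp only [OptExt, List.mem_cons, forall_eq_or_imp]
  tauto

theorem OptExt.accepted_subset (hT : OptExt W G h T) : accepted h ⊆ T := by
  intro v hv
  obtain ⟨p, hp, rfl, hd⟩ := mem_accepted.1 hv
  exact (hT.2 p hp).2 hd

theorem OptExt.notMem_of_rejected (hT : OptExt W G h T) (hv : v ∈ rejected h) : v ∉ T := by
  obtain ⟨p, hp, rfl, hd⟩ := mem_rejected.1 hv
  rw [hT.2 p hp, hd]
  simp

theorem OptExt.cover (hT : OptExt W G h T) {u v : L} (huv : G.Adj u v) : u ∈ T ∨ v ∈ T :=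
  hT.1.1.2 huv

/-- The oracle minimizes among the covers that agree with the history. As soon as one of these is a
minimum cover, the constrained and the unconstrained minimum coincide. -/
theorem isMinCoverExtending_iff (hex : ∃ T, OptExt W G h T) :
    IsMinCoverExtending W G h T ↔ OptExt W G h T := by
  obtain ⟨T₀, h0, h0'⟩ := hex
  constructor
  · rintro ⟨⟨h1, h2, h3⟩, h4⟩
    refine ⟨⟨⟨h1, h2⟩, fun T' h5 h6 => ?_⟩, h3⟩
    exact (h4 T₀ ⟨h0.1.1, h0.1.2, h0'⟩).trans (h0.2 T' h5 h6)
  · rintro ⟨⟨h1, h2⟩, h3⟩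
    exact ⟨⟨h1.1, h1.2, h3⟩, fun T' h5 => h2 T' h5.1 h5.2.1⟩

/-- A vertex can be avoided if at most one of its neighbors is outside of the cover. -/
theorem OptExt.exists_avoiding (hG : ∀ u v, G.Adj u v → u ∈ W ∧ v ∈ W) (hT : OptExt W G h T)
    (hv : v ∉ processed h) (hc : (nbrs W G v \ T).card ≤ 1)
    (hp : Disjoint (nbrs W G v \ T) (processed h)) : ∃ T', OptExt W G h T' ∧ v ∉ T' := by
  by_cases hvT : v ∈ T
  swap
  · exact ⟨T, hT, hvT⟩
  have hmem : ∀ S : Finset L, (∀ u ∈ processed h, u ∈ S ↔ u ∈ T) →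
      ∀ p ∈ h, (p.1.1 ∈ S ↔ p.2 = true) := fun S hS p hp' => by
    rw [hS _ (mem_processed.2 ⟨p, hp', rfl⟩), hT.2 p hp']
  -- The vertex is exchanged for its uncovered neighbors, of which there is at most one.
  have hle : (T.erase v ∪ (nbrs W G v \ T)).card ≤ T.card := by
    refine (Finset.card_union_le _ _).trans ?_
    have := Finset.card_erase_of_mem hvT
    have := Finset.card_pos.2 ⟨v, hvT⟩
    omega
  refine ⟨T.erase v ∪ (nbrs W G v \ T), ⟨⟨⟨?_, ?_⟩, ?_⟩, hmem _ ?_⟩, ?_⟩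
  · intro u hu
    rcases Finset.mem_union.1 hu with hu | hu
    · exact hT.1.1.1 (Finset.mem_of_mem_erase hu)
    · exact nbrs_subset W G v (Finset.mem_sdiff.1 hu).1
  · intro x y hxy
    simp only [Finset.coe_union, Finset.coe_erase, Finset.coe_sdiff, Set.mem_union, Set.mem_sdiff,
      Finset.mem_coe, Set.mem_singleton_iff, mem_nbrs hG]
    rcases hT.cover hxy with hx | hy
    · by_cases hxv : x = v
      · subst hxv
        by_cases hy : y ∈ T
        · exact Or.inr (Or.inl ⟨hy, hxy.ne'⟩)
        · exact Or.inr (Or.inr ⟨hxy, hy⟩)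
      · exact Or.inl (Or.inl ⟨hx, hxv⟩)
    · by_cases hyv : y = v
      · subst hyv
        by_cases hx : x ∈ T
        · exact Or.inl (Or.inl ⟨hx, hxy.ne⟩)
        · exact Or.inl (Or.inr ⟨hxy.symm, hx⟩)
      · exact Or.inr (Or.inl ⟨hy, hyv⟩)
  · exact fun T' h1 h2 => hle.trans (hT.1.2 T' h1 h2)
  · intro u hu
    have h1 : u ≠ v := fun e => hv (e ▸ hu)
    have h2 : u ∉ nbrs W G v \ T := fun h' => Finset.disjoint_left.1 hp h' hu
    simp only [Finset.mem_union, Finset.mem_erase, h1, h2, or_false, ne_eq, not_false_eq_true,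
      true_and]
  · simp [notMem_nbrs_self hG]

/-- Processed neighbors that are not rejected are accepted, hence in the cover. -/
theorem sdiff_subset_cur (hT : OptExt W G h T) (hrej : ¬ HasRej W G h v) :
    nbrs W G v \ T ⊆ nbrs W G v \ processed h := by
  intro u hu
  obtain ⟨h1, h2⟩ := Finset.mem_sdiff.1 hu
  refine Finset.mem_sdiff.2 ⟨h1, fun h3 => ?_⟩
  rw [processed_eq] at h3
  rcases Finset.mem_union.1 h3 with h3 | h3
  · exact h2 (hT.accepted_subset h3)
  · exact hrej ⟨u, Finset.mem_inter.2 ⟨h1, h3⟩⟩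

theorem OptExt.exists_avoiding_of_curDeg (hG : ∀ u v, G.Adj u v → u ∈ W ∧ v ∈ W)
    (hT : OptExt W G h T) (hv : v ∉ processed h) (hrej : ¬ HasRej W G h v)
    (hc : curDeg h (item W G v) ≤ 1) : ∃ T', OptExt W G h T' ∧ v ∉ T' := by
  have hsub := sdiff_subset_cur hT hrej
  exact hT.exists_avoiding hG hv ((Finset.card_le_card hsub).trans hc)
    (Finset.disjoint_of_subset_left hsub Finset.sdiff_disjoint)

theorem OptExt.mem_of_hasRej (hG : ∀ u v, G.Adj u v → u ∈ W ∧ v ∈ W) (hT : OptExt W G h T)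
    (hrej : HasRej W G h v) : v ∈ T := by
  obtain ⟨u, hu⟩ := hrej
  obtain ⟨h1, h2⟩ := Finset.mem_inter.1 hu
  exact (hT.cover ((mem_nbrs hG).1 h1)).resolve_right (hT.notMem_of_rejected h2)

/-- A minimum cover contains at most one neighbor of an advised vertex. -/
def AdvInv (W : Finset L) (G : SimpleGraph L) (h : History L) : Prop :=
  ∀ p ∈ (memory h).1, ∀ T, OptExt W G h T → (p.2 ∩ T).card ≤ 1

/-- A longer history admits fewer covers, so only a newly advised item needs an argument. -/
theorem AdvInv.cons_of_memory (ha : AdvInv W G h) {x : Item L} {d : Bool}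
    (hm : (memory ((x, d) :: h)).1 = (memory h).1) : AdvInv W G ((x, d) :: h) := by
  intro p hp T hT
  rw [hm] at hp
  exact ha p hp T (optExt_cons.1 hT).1

/-- Rule 4 is sound: the accepted neighbor of the advised vertex is already the one that the cover
may contain. -/
theorem IsSibling.notMem (ha : AdvInv W G h) (hs : IsSibling h v) (hv : v ∉ processed h)
    (hT : OptExt W G h T) : v ∉ T := by
  obtain ⟨p, hp, hvp, u, hu⟩ := hs
  obtain ⟨h1, h2⟩ := Finset.mem_inter.1 hu
  intro hvT
  have h3 := ha p hp T hT
  have : u = v := Finset.card_le_one.1 h3 u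
    (Finset.mem_inter.2 ⟨h1, hT.accepted_subset h2⟩) v (Finset.mem_inter.2 ⟨hvp, hvT⟩)
  exact hv (this ▸ accepted_subset_processed h h2)

/-- Rule 5 without advice is sound: one of two common neighbors with an advised vertex is missing
from the cover, and the edge to it forces the vertex. -/
theorem mem_of_two_le_maxCommon (hG : ∀ u v, G.Adj u v → u ∈ W ∧ v ∈ W) (ha : AdvInv W G h)
    (hc : 2 ≤ maxCommon (memory h).1 (item W G v)) (hT : OptExt W G h T) : v ∈ T := by
  obtain ⟨p, hp, he⟩ := exists_maxCommon (A := (memory h).1) (x := item W G v) (by omega)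
  have h1 := ha p hp T hT
  have h2 : ¬ (nbrs W G v ∩ p.2 ⊆ p.2 ∩ T) := fun hs => by
    have h3 := Finset.card_le_card hs
    have h4 : (nbrs W G v ∩ p.2).card = maxCommon (memory h).1 (item W G v) := he
    omega
  obtain ⟨u, hu, hu'⟩ := Finset.not_subset.1 h2
  obtain ⟨h3, h4⟩ := Finset.mem_inter.1 hu
  refine (hT.cover ((mem_nbrs hG).1 h3)).resolve_right fun h5 => hu' ?_
  exact Finset.mem_inter.2 ⟨h4, h5⟩

/-- Before the cycles are processed, an unadvised step keeps an optimum cover. -/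
theorem step_unadvised (hG : ∀ u v, G.Adj u v → u ∈ W ∧ v ∈ W) (hm : (memory h).2 = false)
    (hex : ∃ T, OptExt W G h T) (ha : AdvInv W G h) (hv : v ∈ unproc W h)
    (hn : ¬ NeedsAdvice h (item W G v)) (hk : kind h (item W G v) ≠ .degTwo) {d : Bool}
    (hd : decideItem h (item W G v) = .answer d) :
    (∃ T, OptExt W G ((item W G v, d) :: h) T) ∧ AdvInv W G ((item W G v, d) :: h) := by
  have hvp := (Finset.mem_sdiff.1 hv).2
  obtain ⟨T, hT⟩ := hex
  have hkk := kind_pre hm (item W G v)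
  have hmem : kind h (item W G v) ≠ .degThree → AdvInv W G ((item W G v, d) :: h) :=
    fun hne => ha.cons_of_memory (memory_fst_cons_of_ne hne)
  split_ifs at hkk with h1 h2 h3 h4 h5
  · simp only [decideItem, hkk, AdviceTree.answer.injEq] at hd
    subst hd
    exact ⟨⟨T, optExt_cons.2 ⟨hT, by simpa using hT.mem_of_hasRej hG h1⟩⟩, hmem (by simp [hkk])⟩
  · simp only [decideItem, hkk, AdviceTree.answer.injEq] at hd
    subst hd
    obtain ⟨T', hT', hvT⟩ := hT.exists_avoiding_of_curDeg hG hvp h1 (by omega)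
    exact ⟨⟨T', optExt_cons.2 ⟨hT', by simpa using hvT⟩⟩, hmem (by simp [hkk])⟩
  · simp only [decideItem, hkk, AdviceTree.answer.injEq] at hd
    subst hd
    obtain ⟨T', hT', hvT⟩ := hT.exists_avoiding_of_curDeg hG hvp h1 (by omega)
    exact ⟨⟨T', optExt_cons.2 ⟨hT', by simpa using hvT⟩⟩, hmem (by simp [hkk])⟩
  · simp only [decideItem, hkk, AdviceTree.answer.injEq] at hd
    subst hd
    refine ⟨⟨T, optExt_cons.2 ⟨hT, ?_⟩⟩, hmem (by simp [hkk])⟩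
    simpa using IsSibling.notMem ha h4 hvp hT
  · have hc : 2 ≤ maxCommon (memory h).1 (item W G v) := by
      by_contra hc
      exact hn ⟨hkk, by omega⟩
    simp only [decideItem, hkk, if_pos hc, AdviceTree.answer.injEq] at hd
    subst hd
    refine ⟨⟨T, optExt_cons.2 ⟨hT, by simpa using mem_of_two_le_maxCommon hG ha hc hT⟩⟩,
      ha.cons_of_memory ?_⟩
    rw [memory_fst_cons_degThree hkk, if_neg (by omega)]
  · exact absurd hkk hk

/-- A step with advice keeps an optimum cover. -/
theorem step_advised (hG : ∀ u v, G.Adj u v → u ∈ W ∧ v ∈ W)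
    (hdeg : ∀ v ∈ W, (nbrs W G v).card ≤ 3)
    (hex : ∃ T, OptExt W G h T) (ha : AdvInv W G h) (hv : v ∈ unproc W h)
    (hn : NeedsAdvice h (item W G v)) {d : Bool}
    (hd : d = true ↔ ∀ T, IsMinCoverExtending W G h T → v ∈ T) :
    (∃ T, OptExt W G ((item W G v, d) :: h) T) ∧ AdvInv W G ((item W G v, d) :: h) := by
  obtain ⟨hvW, hvp⟩ := Finset.mem_sdiff.1 hv
  simp only [isMinCoverExtending_iff hex] at hd
  have hmem := memory_fst_cons_degThree (d := d) hn.1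
  cases d
  · simp only [Bool.false_eq_true, false_iff, not_forall] at hd
    obtain ⟨T, hT, hvT⟩ := hd
    refine ⟨⟨T, optExt_cons.2 ⟨hT, by simpa using hvT⟩⟩, ha.cons_of_memory ?_⟩
    rw [hmem, if_neg (by simp)]
  · simp only [true_iff] at hd
    obtain ⟨T, hT⟩ := hex
    refine ⟨⟨T, optExt_cons.2 ⟨hT, by simpa using hd T hT⟩⟩, ?_⟩
    intro p hp T' hT'
    have hT'' := (optExt_cons.1 hT').1
    rw [hmem, if_pos ⟨rfl, hn.2⟩] at hp
    rcases List.mem_cons.1 hp with rfl | hp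
    -- With two of the three neighbors in the cover, at most one is uncovered, so the exchange
    -- yields an agreeing minimum cover that avoids the vertex, against the oracle's bit.
    · by_contra hc
      obtain ⟨hdis, h3⟩ := nbrs_of_curDeg_eq_three hdeg hvW (curDeg_of_kind_degThree hn.1)
      have h4 := Finset.card_sdiff_add_card_inter (nbrs W G v) T'
      have h5 : ¬ (nbrs W G v ∩ T').card ≤ 1 := hc
      obtain ⟨S, hS, hvS⟩ := hT''.exists_avoiding hG hvp (by omega)
        (Finset.disjoint_of_subset_left Finset.sdiff_subset hdis)
      exact hvS (hd S hS)
    · exact ha p hp T' hT''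

end Local

/-! ### The weight of the unprocessed vertices -/

section Weight

variable {L : Type*} [DecidableEq L]

/-- The weight of a vertex, if `S` are the seen vertices and `M` the marked ones. -/
def weight (S M : Finset L) (x : L) : ℕ := if x ∈ S then if x ∈ M then 4 else 8 else 15

/-- The total weight of `U`. -/
def totalWeight (U S M : Finset L) : ℕ := ∑ x ∈ U, weight S M x

theorem four_le_weight (S M : Finset L) (x : L) : 4 ≤ weight S M x := by
  unfold weight; split_ifs <;> omega

theorem weight_of_notMem {S M : Finset L} {x : L} (hx : x ∉ S) : weight S M x = 15 := by
  simp [weight, hx]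

theorem eight_le_weight {S M : Finset L} {x : L} (hx : x ∉ M) : 8 ≤ weight S M x := by
  unfold weight; split_ifs <;> omega

/-- A set `U₀` of vertices of degree two or three has shrunk to `U`, again with minimum degree two.
The neighbors of `x` are `N x`. The sets of seen vertices are `S₀` and `S`; a vertex of `U` is seen
if it has lost a neighbor. Marked vertices have only neighbors of degree two. -/
structure Shrink (N : L → Finset L) (U₀ U S₀ S M : Finset L) : Prop where
  symm : ∀ {x y}, x ∈ N y → y ∈ N x
  irrefl : ∀ x, x ∉ N x
  subset : U ⊆ U₀
  two_le : ∀ x ∈ U₀, 2 ≤ (N x ∩ U₀).card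
  le_three : ∀ x ∈ U₀, (N x ∩ U₀).card ≤ 3
  card_seen : ∀ x ∈ U₀, x ∈ S₀ → (N x ∩ U₀).card = 2
  two_le' : ∀ x ∈ U, 2 ≤ (N x ∩ U).card
  seen_iff : ∀ x ∈ U, x ∈ S ↔ x ∈ S₀ ∨ (N x ∩ (U₀ \ U)).Nonempty
  marked_seen : M ⊆ S₀
  marked : ∀ m ∈ M, m ∈ U₀ → ∀ y ∈ N m ∩ U₀, (N y ∩ U₀).card = 2 ∧ (y ∈ S₀ → y ∈ M)

namespace Shrink

variable {N : L → Finset L} {U₀ U S₀ S M : Finset L} (hs : Shrink N U₀ U S₀ S M)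
include hs

/-- What the vertex `x` contributes to the loss of weight. -/
def gain (U S₀ S M : Finset L) (x : L) : ℕ :=
  if x ∈ U then weight S₀ M x - weight S M x else weight S₀ M x

theorem ne_of_mem {x y : L} (hy : y ∈ N x) : x ≠ y := by
  rintro rfl; exact hs.irrefl x hy

theorem card_split (x : L) :
    (N x ∩ U).card + (N x ∩ (U₀ \ U)).card = (N x ∩ U₀).card := by
  rw [← Finset.card_union_of_disjoint, ← Finset.inter_union_distrib_left,
    Finset.union_sdiff_of_subset hs.subset]
  exact Finset.disjoint_of_subset_left Finset.inter_subset_right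
    (Finset.disjoint_of_subset_right Finset.inter_subset_right Finset.disjoint_sdiff)

/-- A survivor keeps at least two of at most three neighbors. If it lost one, it had three and lost
only this one; having had three, it was unseen. -/
theorem boundary {x p : L} (hx : x ∈ U) (hp : p ∈ N x) (hp' : p ∈ U₀ \ U) :
    (N x ∩ U₀).card = 3 ∧ x ∉ S₀ ∧ x ∈ S ∧ ∀ q ∈ N x, q ∈ U₀ \ U → q = p := by
  have h1 := hs.card_split x
  have h2 := hs.two_le' x hx
  have h3 := hs.le_three x (hs.subset hx)
  have hpm : p ∈ N x ∩ (U₀ \ U) := Finset.mem_inter.2 ⟨hp, hp'⟩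
  have h4 := Finset.card_pos.2 ⟨p, hpm⟩
  refine ⟨by omega, fun h5 => ?_, (hs.seen_iff x hx).2 (Or.inr ⟨p, hpm⟩), fun q hq hq' => ?_⟩
  · have := hs.card_seen x (hs.subset hx) h5
    omega
  · exact Finset.card_le_one.1 (by omega : (N x ∩ (U₀ \ U)).card ≤ 1) q
      (Finset.mem_inter.2 ⟨hq, hq'⟩) p hpm

theorem weight_le {x : L} (hx : x ∈ U) : weight S M x ≤ weight S₀ M x := by
  unfold weight
  have := hs.seen_iff x hx
  split_ifs <;> first | omega | tauto

theorem totalWeight_eq :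
    totalWeight U₀ S₀ M = totalWeight U S M + ∑ x ∈ U₀, gain U S₀ S M x := by
  unfold totalWeight
  rw [← Finset.sum_sdiff hs.subset, ← Finset.sum_sdiff hs.subset (f := gain U S₀ S M)]
  have h1 : ∑ x ∈ U₀ \ U, gain U S₀ S M x = ∑ x ∈ U₀ \ U, weight S₀ M x :=
    Finset.sum_congr rfl fun x hx => by simp [gain, (Finset.mem_sdiff.1 hx).2]
  have h2 : ∑ x ∈ U, weight S₀ M x = ∑ x ∈ U, weight S M x + ∑ x ∈ U, gain U S₀ S M x := by
    rw [← Finset.sum_add_distrib]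
    refine Finset.sum_congr rfl fun x hx => ?_
    have := hs.weight_le hx
    simp only [gain, hx, if_true]
    omega
  omega

/-- No vertex has a negative gain, so any list of distinct vertices gives a lower bound for the
loss. -/
theorem le_of_gain {l : List L} (hl : l.Nodup) (hU : ∀ x ∈ l, x ∈ U₀) :
    totalWeight U S M + (l.map (gain U S₀ S M)).sum ≤ totalWeight U₀ S₀ M := by
  rw [hs.totalWeight_eq]
  refine Nat.add_le_add_left ?_ _
  rw [← List.sum_toFinset _ hl]
  exact Finset.sum_le_sum_of_subset fun x hx => hU x (List.mem_toFinset.1 hx)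

omit hs in
theorem gain_of_proc {x : L} (hx : x ∈ U₀ \ U) : gain U S₀ S M x = weight S₀ M x := by
  simp [gain, (Finset.mem_sdiff.1 hx).2]

omit hs in
theorem gain_unseen {x : L} (hx : x ∈ U₀ \ U) (hx' : x ∉ S₀) : gain U S₀ S M x = 15 := by
  rw [gain_of_proc hx, weight_of_notMem hx']

omit hs in
theorem gain_unmarked {x : L} (hx : x ∈ U₀ \ U) (hx' : x ∉ M) : 8 ≤ gain U S₀ S M x := by
  rw [gain_of_proc hx]; exact eight_le_weight hx'

theorem gain_boundary {x p : L} (hx : x ∈ U) (hp : p ∈ N x) (hp' : p ∈ U₀ \ U) :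
    gain U S₀ S M x = 7 := by
  obtain ⟨-, h1, h2, -⟩ := hs.boundary hx hp hp'
  have h3 : x ∉ M := fun h => h1 (hs.marked_seen h)
  simp [gain, hx, weight, h1, h2, h3]

/-- A survivor next to a processed vertex drops from 15 to 8. A processed vertex loses its whole
weight, at least 4, and at least 8 if it is unmarked. -/
theorem gain_touched {x p : L} (hx : x ∈ U₀) (hp : p ∈ N x) (hp' : p ∈ U₀ \ U) :
    4 ≤ gain U S₀ S M x ∧ (x ∉ M → 7 ≤ gain U S₀ S M x) := by
  by_cases hxU : x ∈ U
  · rw [hs.gain_boundary hxU hp hp']; omega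
  · have hx' := Finset.mem_sdiff.2 ⟨hx, hxU⟩
    refine ⟨?_, fun h => ?_⟩
    · rw [gain_of_proc hx']; exact four_le_weight _ _ _
    · have := gain_unmarked (S₀ := S₀) (S := S) hx' h; omega

theorem notMem_marked {x w : L} (hw : w ∈ U₀) (hx : x ∈ N w) (hx' : x ∈ U₀)
    (h3 : (N w ∩ U₀).card = 3) : x ∉ M := by
  intro hm
  have := (hs.marked x hm hx' w (Finset.mem_inter.2 ⟨hs.symm hx, hw⟩)).1
  omega

/-- Seen neighbors of marked vertices are marked, so marks do not border on seen unmarked vertices.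
-/
theorem notMem_marked_of_seen {x y : L} (hx : x ∈ U₀) (hxS : x ∈ S₀) (hxM : x ∉ M) (hy : y ∈ N x)
    (hy' : y ∈ U₀) : y ∉ M := by
  intro hm
  exact hxM ((hs.marked y hm hy' x (Finset.mem_inter.2 ⟨hs.symm hy, hx⟩)).2 hxS)

theorem exists_other {x : L} (hx : x ∈ U₀) (w : L) : ∃ z ∈ N x ∩ U₀, z ≠ w := by
  by_contra hc
  push Not at hc
  have h1 := hs.two_le x hx
  have h2 : (N x ∩ U₀) ⊆ {w} := fun z hz => Finset.mem_singleton.2 (hc z hz)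
  have := Finset.card_le_card h2
  simp at this
  omega

omit hs in
theorem eq_of_card_two {s : Finset L} (h : s.card = 2) {x y z : L} (hx : x ∈ s) (hy : y ∈ s)
    (hxy : x ≠ y) (hz : z ∈ s) : z = x ∨ z = y := by
  have : ({x, y} : Finset L) = s :=
    Finset.eq_of_subset_of_card_le (by intro a ha; simp at ha; rcases ha with rfl | rfl <;> assumption)
      (by rw [h, Finset.card_pair hxy])
  rw [← this] at hz
  simpa using hz

/-! ### Lower bounds for the loss of weight -/

variable {w a b c : L}

/-- If a vertex of degree three and all of its neighbors are processed, then the weight decreases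
by at least 46. -/
theorem gain_closed (hw : w ∈ U₀ \ U) (hwS : w ∉ S₀) (hN : N w ∩ U₀ = {a, b, c}) (hab : a ≠ b)
    (hac : a ≠ c) (hbc : b ≠ c) (ha : a ∈ U₀ \ U) (hb : b ∈ U₀ \ U) (hc : c ∈ U₀ \ U) :
    totalWeight U S M + 46 ≤ totalWeight U₀ S₀ M := by
  have hw0 := (Finset.mem_sdiff.1 hw).1
  have ha0 := (Finset.mem_sdiff.1 ha).1
  have hb0 := (Finset.mem_sdiff.1 hb).1
  have hc0 := (Finset.mem_sdiff.1 hc).1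
  have h3 : (N w ∩ U₀).card = 3 := by rw [hN]; exact Finset.card_eq_three.2 ⟨a, b, c, hab, hac, hbc, rfl⟩
  have hmem : ∀ x, x ∈ N w ∩ U₀ ↔ x = a ∨ x = b ∨ x = c := by intro x; rw [hN]; simp
  have haN := Finset.mem_inter.1 ((hmem a).2 (by simp))
  have hbN := Finset.mem_inter.1 ((hmem b).2 (by simp))
  have hcN := Finset.mem_inter.1 ((hmem c).2 (by simp))
  have hwa := hs.ne_of_mem haN.1
  have hwb := hs.ne_of_mem hbN.1
  have hwc := hs.ne_of_mem hcN.1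
  have haM := hs.notMem_marked hw0 haN.1 ha0 h3
  have hbM := hs.notMem_marked hw0 hbN.1 hb0 h3
  have hcM := hs.notMem_marked hw0 hcN.1 hc0 h3
  have gw := gain_unseen (S := S) (M := M) hw hwS
  have ga := gain_unmarked (S₀ := S₀) (S := S) ha haM
  have gb := gain_unmarked (S₀ := S₀) (S := S) hb hbM
  have gc := gain_unmarked (S₀ := S₀) (S := S) hc hcM
  by_cases hall : a ∈ S₀ ∧ b ∈ S₀ ∧ c ∈ S₀
  · obtain ⟨haS, hbS, hcS⟩ := hall
    -- The four vertices give 15 + 3 · 8 = 39, and 7 are missing. Each of `a`, `b`, `c` has exactly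
    -- one neighbor besides `w`. If these all lay in `{a, b, c}`, they would match three vertices
    -- perfectly, which is impossible. So a further vertex is touched, unmarked because it is next
    -- to a seen unmarked one.
    obtain ⟨t, ht, p, hp, hpP, hpM⟩ : ∃ t ∈ U₀, ∃ p ∈ N t, p ∈ U₀ \ U ∧
        (t ∉ M ∧ t ≠ w ∧ t ≠ a ∧ t ≠ b ∧ t ≠ c) := by
      by_contra hcon
      push Not at hcon
      have key : ∀ x ∈ U₀ \ U, x ∈ S₀ → x ∉ M → ∀ t ∈ N x ∩ U₀, t ≠ w → t = a ∨ t = b ∨ t = c := by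
        intro x hx hxS hxM t ht htw
        obtain ⟨h1, h2⟩ := Finset.mem_inter.1 ht
        have := hcon t h2 x (hs.symm h1) hx
          (hs.notMem_marked_of_seen (Finset.mem_sdiff.1 hx).1 hxS hxM h1 h2) htw
        tauto
      have huniq : ∀ x ∈ U₀, x ∈ S₀ → x ∈ N w → ∀ y ∈ N x ∩ U₀, ∀ z ∈ N x ∩ U₀, y ≠ w → z ≠ w →
          y = z := by
        intro x hx hxS hxw y hy z hz hyw hzw
        have := eq_of_card_two (hs.card_seen x hx hxS) (Finset.mem_inter.2 ⟨hs.symm hxw, hw0⟩) hy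
          hyw.symm hz
        tauto
      obtain ⟨ta, hta, htaw⟩ := hs.exists_other ha0 w
      obtain ⟨tb, htb, htbw⟩ := hs.exists_other hb0 w
      obtain ⟨tc, htc, htcw⟩ := hs.exists_other hc0 w
      have e1 := key a ha haS haM ta hta htaw
      have e2 := key b hb hbS hbM tb htb htbw
      have e3 := key c hc hcS hcM tc htc htcw
      have n1 : ta ≠ a := fun e => hs.irrefl a (by subst e; exact (Finset.mem_inter.1 hta).1)
      have n2 : tb ≠ b := fun e => hs.irrefl b (by subst e; exact (Finset.mem_inter.1 htb).1)
      have n3 : tc ≠ c := fun e => hs.irrefl c (by subst e; exact (Finset.mem_inter.1 htc).1)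
      have sy : ∀ x y, x ∈ U₀ → y ∈ N x ∩ U₀ → x ∈ N y ∩ U₀ := fun x y hx hy =>
        Finset.mem_inter.2 ⟨hs.symm (Finset.mem_inter.1 hy).1, hx⟩
      have m1 := sy a ta ha0 hta
      have m2 := sy b tb hb0 htb
      have m3 := sy c tc hc0 htc
      have u1 := huniq a ha0 haS haN.1
      have u2 := huniq b hb0 hbS hbN.1
      have u3 := huniq c hc0 hcS hcN.1
      rcases e1 with e1 | e1 | e1
      · exact n1 e1
      · subst e1
        have := u2 tb htb a m1 htbw hwa.symm
        subst this
        rcases e3 with e3 | e3 | e3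
        · subst e3
          exact hbc (u1 ta hta c m3 htaw hwc.symm)
        · subst e3
          exact hac (u2 _ m1 c m3 hwa.symm hwc.symm)
        · exact n3 e3
      · subst e1
        have := u3 tc htc a m1 htcw hwa.symm
        subst this
        rcases e2 with e2 | e2 | e2
        · subst e2
          exact hbc (u1 _ hta b m2 htaw hwb.symm).symm
        · exact n2 e2
        · subst e2
          exact hab (u3 _ m1 b m2 hwa.symm hwb.symm)
    have gt := (hs.gain_touched ht hp hpP).2 hpM.1
    have := hs.le_of_gain (l := [w, a, b, c, t])
      (by simp [hwa, hwb, hwc, hab, hac, hbc, hpM.2.1.symm, hpM.2.2.1.symm, hpM.2.2.2.1.symm,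
        hpM.2.2.2.2.symm])
      (by simp [hw0, ha0, hb0, hc0, ht])
    simp only [List.map_cons, List.map_nil, List.sum_cons, List.sum_nil] at this
    omega
  -- One of the three neighbors is unseen: 15 + 15 + 8 + 8 = 46.
  · have := hs.le_of_gain (l := [w, a, b, c])
      (by simp [hwa, hwb, hwc, hab, hac, hbc]) (by simp [hw0, ha0, hb0, hc0])
    simp only [List.map_cons, List.map_nil, List.sum_cons, List.sum_nil] at this
    by_cases haS : a ∈ S₀
    · by_cases hbS : b ∈ S₀
      · have := gain_unseen (S := S) (M := M) hc (fun h => hall ⟨haS, hbS, h⟩)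
        omega
      · have := gain_unseen (S := S) (M := M) hb hbS
        omega
    · have := gain_unseen (S := S) (M := M) ha haS
      omega

/-- If a vertex `w` of degree three, a neighbor `a` of degree two, and the other neighbor `z` of
`a` are processed, and `z` is not adjacent to `w`, then the weight decreases by at least 46. -/
theorem gain_path (hw : w ∈ U₀ \ U) (hwS : w ∉ S₀) (hN : N w ∩ U₀ = {a, b, c}) (hab : a ≠ b)
    (hac : a ≠ c) (hbc : b ≠ c) (ha : a ∈ U₀ \ U) {z : L}
    (hz : z ∈ U₀ \ U) (hza : z ∈ N a) (hzw : z ≠ w) (hzN : z ∉ N w) :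
    totalWeight U S M + 46 ≤ totalWeight U₀ S₀ M := by
  have hw0 := (Finset.mem_sdiff.1 hw).1
  have ha0 := (Finset.mem_sdiff.1 ha).1
  have hz0 := (Finset.mem_sdiff.1 hz).1
  have h3 : (N w ∩ U₀).card = 3 := by rw [hN]; exact Finset.card_eq_three.2 ⟨a, b, c, hab, hac, hbc, rfl⟩
  have hmem : ∀ x, x ∈ N w ∩ U₀ ↔ x = a ∨ x = b ∨ x = c := by intro x; rw [hN]; simp
  have haN := Finset.mem_inter.1 ((hmem a).2 (by simp))
  have hbN := Finset.mem_inter.1 ((hmem b).2 (by simp))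
  have hcN := Finset.mem_inter.1 ((hmem c).2 (by simp))
  have hwa := hs.ne_of_mem haN.1
  have hwb := hs.ne_of_mem hbN.1
  have hwc := hs.ne_of_mem hcN.1
  have hza' : z ≠ a := fun e => hzN (e ▸ haN.1)
  have hzb : z ≠ b := fun e => hzN (e ▸ hbN.1)
  have hzc : z ≠ c := fun e => hzN (e ▸ hcN.1)
  have haM := hs.notMem_marked hw0 haN.1 ha0 h3
  have hbM := hs.notMem_marked hw0 hbN.1 hbN.2 h3
  have hcM := hs.notMem_marked hw0 hcN.1 hcN.2 h3
  have gw := gain_unseen (S := S) (M := M) hw hwS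
  have ga := gain_unmarked (S₀ := S₀) (S := S) ha haM
  have gb := (hs.gain_touched hbN.2 (hs.symm hbN.1) hw).2 hbM
  have gc := (hs.gain_touched hcN.2 (hs.symm hcN.1) hw).2 hcM
  have gz : 4 ≤ gain U S₀ S M z := by rw [gain_of_proc hz]; exact four_le_weight _ _ _
  have hsum := hs.le_of_gain (l := [w, a, z, b, c])
      (by simp [hwa, hwb, hwc, hab, hac, hbc, hzw.symm, hza'.symm, hzb, hzc])
      (by simp [hw0, ha0, hbN.2, hcN.2, hz0])
  simp only [List.map_cons, List.map_nil, List.sum_cons, List.sum_nil] at hsum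
  -- If `z` is marked, then `a` is unseen, and the gains are 15 + 15 + 4 + 7 + 7 = 48.
  by_cases hzM : z ∈ M
  · have haS : a ∉ S₀ := fun haS => hs.notMem_marked_of_seen ha0 haS haM hza hz0 hzM
    have := gain_unseen (S := S) (M := M) ha haS
    omega
  have gz := gain_unmarked (S₀ := S₀) (S := S) hz hzM
  by_cases hzS : z ∈ S₀
  swap
  · have := gain_unseen (S := S) (M := M) hz hzS
    omega
  -- So far 15 + 8 + 8 + 7 + 7 = 45, one short. If `b` or `c` is processed as well, it contributes 8
  -- instead of 7.
  by_cases hbU : b ∈ U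
  swap
  · have := gain_unmarked (S₀ := S₀) (S := S) (Finset.mem_sdiff.2 ⟨hbN.2, hbU⟩) hbM
    omega
  by_cases hcU : c ∈ U
  swap
  · have := gain_unmarked (S₀ := S₀) (S := S) (Finset.mem_sdiff.2 ⟨hcN.2, hcU⟩) hcM
    omega
  -- The second neighbor of `z` supplies the rest. It is neither `b` nor `c`, since these survive
  -- and so lost only `w`.
  obtain ⟨s, hsz, hsa⟩ := hs.exists_other hz0 a
  obtain ⟨hsz, hs0⟩ := Finset.mem_inter.1 hsz
  have hsw : s ≠ w := fun e => hzN (hs.symm (e ▸ hsz))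
  have hsb : s ≠ b := fun e => hzw <| by
    subst e
    exact (hs.boundary hbU (hs.symm hbN.1) hw).2.2.2 z (hs.symm hsz) hz
  have hsc : s ≠ c := fun e => hzw <| by
    subst e
    exact (hs.boundary hcU (hs.symm hcN.1) hw).2.2.2 z (hs.symm hsz) hz
  have hszn := (hs.ne_of_mem hsz).symm
  have gs := (hs.gain_touched hs0 (hs.symm hsz) hz).2 (hs.notMem_marked_of_seen hz0 hzS hzM hsz hs0)
  have hsum := hs.le_of_gain (l := [w, a, z, b, c, s])
      (by simp [hwa, hwb, hwc, hab, hac, hbc, hzw.symm, hza'.symm, hzb, hzc, hsw.symm, hsa.symm,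
        hsb.symm, hsc.symm, hszn.symm])
      (by simp [hw0, ha0, hbN.2, hcN.2, hz0, hs0])
  simp only [List.map_cons, List.map_nil, List.sum_cons, List.sum_nil] at hsum
  omega

/-- If `w` has exactly one seen neighbor, and `w` and its neighbors are processed, then the weight
decreases by at least 56, or nothing else is affected. -/
theorem gain_closed_of_seen (hw : w ∈ U₀ \ U) (hwS : w ∉ S₀) (hN : N w ∩ U₀ = {a, b, c})
    (hab : a ≠ b) (hac : a ≠ c) (hbc : b ≠ c) (ha : a ∈ U₀ \ U) (hb : b ∈ U₀ \ U)
    (hc : c ∈ U₀ \ U) (hbS : b ∉ S₀) (hcS : c ∉ S₀) :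
    totalWeight U S M + 53 ≤ totalWeight U₀ S₀ M ∧
      (totalWeight U S M + 56 ≤ totalWeight U₀ S₀ M ∨
        (U₀ \ U ⊆ {w, a, b, c} ∧ ∀ x ∈ U, x ∈ S → x ∈ S₀)) := by
  have hw0 := (Finset.mem_sdiff.1 hw).1
  have ha0 := (Finset.mem_sdiff.1 ha).1
  have hb0 := (Finset.mem_sdiff.1 hb).1
  have hc0 := (Finset.mem_sdiff.1 hc).1
  have h3 : (N w ∩ U₀).card = 3 := by rw [hN]; exact Finset.card_eq_three.2 ⟨a, b, c, hab, hac, hbc, rfl⟩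
  have hmem : ∀ x, x ∈ N w ∩ U₀ ↔ x = a ∨ x = b ∨ x = c := by intro x; rw [hN]; simp
  have haN := Finset.mem_inter.1 ((hmem a).2 (by simp))
  have hbN := Finset.mem_inter.1 ((hmem b).2 (by simp))
  have hcN := Finset.mem_inter.1 ((hmem c).2 (by simp))
  have hwa := hs.ne_of_mem haN.1
  have hwb := hs.ne_of_mem hbN.1
  have hwc := hs.ne_of_mem hcN.1
  have gw := gain_unseen (S := S) (M := M) hw hwS
  have ga := gain_unmarked (S₀ := S₀) (S := S) ha (hs.notMem_marked hw0 haN.1 ha0 h3)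
  have gb := gain_unseen (S := S) (M := M) hb hbS
  have gc := gain_unseen (S := S) (M := M) hc hcS
  refine ⟨?_, ?_⟩
  · have := hs.le_of_gain (l := [w, a, b, c])
      (by simp [hwa, hwb, hwc, hab, hac, hbc]) (by simp [hw0, ha0, hb0, hc0])
    simp only [List.map_cons, List.map_nil, List.sum_cons, List.sum_nil] at this
    omega
  -- The four vertices give 15 + 8 + 15 + 15 = 53. Any further processed or newly seen vertex adds
  -- at least 4.
  · by_cases ht : ∃ t ∈ U₀, 4 ≤ gain U S₀ S M t ∧ t ≠ w ∧ t ≠ a ∧ t ≠ b ∧ t ≠ c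
    · obtain ⟨t, ht, gt, htw, hta, htb, htc⟩ := ht
      have := hs.le_of_gain (l := [w, a, b, c, t])
        (by simp [hwa, hwb, hwc, hab, hac, hbc, htw.symm, hta.symm, htb.symm, htc.symm])
        (by simp [hw0, ha0, hb0, hc0, ht])
      simp only [List.map_cons, List.map_nil, List.sum_cons, List.sum_nil] at this
      omega
    · push Not at ht
      refine Or.inr ⟨fun x hx => ?_, fun x hx hxS => ?_⟩
      · have h1 : 4 ≤ gain U S₀ S M x := by rw [gain_of_proc hx]; exact four_le_weight _ _ _
        have := ht x (Finset.mem_sdiff.1 hx).1 h1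
        simp only [Finset.mem_insert, Finset.mem_singleton]
        tauto
      · refine ((hs.seen_iff x hx).1 hxS).resolve_right ?_
        rintro ⟨p, hp⟩
        obtain ⟨hp, hp'⟩ := Finset.mem_inter.1 hp
        have h1 := (hs.gain_touched (hs.subset hx) hp hp').1
        have h2 := ht x (hs.subset hx) h1
        have hxU : x ∉ U₀ \ U := fun h => (Finset.mem_sdiff.1 h).2 hx
        by_cases e1 : x = w
        · exact hxU (e1 ▸ hw)
        by_cases e2 : x = a
        · exact hxU (e2 ▸ ha)
        by_cases e3 : x = b
        · exact hxU (e3 ▸ hb)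
        exact hxU (h2 e1 e2 e3 ▸ hc)

/-- In the situation of `gain_path`, let `a` be the only seen neighbor of `w`. The weight decreases
by 56, unless `z` is seen and there is no further processed vertex that was seen, unmarked
and not adjacent to `w`. -/
theorem gain_path_of_seen (hw : w ∈ U₀ \ U) (hwS : w ∉ S₀) (hN : N w ∩ U₀ = {a, b, c})
    (hab : a ≠ b) (hac : a ≠ c) (hbc : b ≠ c) (ha : a ∈ U₀ \ U) (haS : a ∈ S₀) (hbS : b ∉ S₀)
    (hcS : c ∉ S₀) {z : L} (hz : z ∈ U₀ \ U) (hza : z ∈ N a) (hzw : z ≠ w) (hzN : z ∉ N w) :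
    totalWeight U S M + 49 ≤ totalWeight U₀ S₀ M ∧
      (totalWeight U S M + 56 ≤ totalWeight U₀ S₀ M ∨
        (z ∈ S₀ ∧ ∀ k ∈ U₀ \ U, k ∈ S₀ → k ∉ M → k = a ∨ k = z)) := by
  have hw0 := (Finset.mem_sdiff.1 hw).1
  have ha0 := (Finset.mem_sdiff.1 ha).1
  have hz0 := (Finset.mem_sdiff.1 hz).1
  have h3 : (N w ∩ U₀).card = 3 := by rw [hN]; exact Finset.card_eq_three.2 ⟨a, b, c, hab, hac, hbc, rfl⟩
  have hmem : ∀ x, x ∈ N w ∩ U₀ ↔ x = a ∨ x = b ∨ x = c := by intro x; rw [hN]; simp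
  have haN := Finset.mem_inter.1 ((hmem a).2 (by simp))
  have hbN := Finset.mem_inter.1 ((hmem b).2 (by simp))
  have hcN := Finset.mem_inter.1 ((hmem c).2 (by simp))
  have hwa := hs.ne_of_mem haN.1
  have hwb := hs.ne_of_mem hbN.1
  have hwc := hs.ne_of_mem hcN.1
  have hza' : z ≠ a := fun e => hzN (e ▸ haN.1)
  have hzb : z ≠ b := fun e => hzN (e ▸ hbN.1)
  have hzc : z ≠ c := fun e => hzN (e ▸ hcN.1)
  have haM := hs.notMem_marked hw0 haN.1 ha0 h3
  have hbM := hs.notMem_marked hw0 hbN.1 hbN.2 h3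
  have hcM := hs.notMem_marked hw0 hcN.1 hcN.2 h3
  have hzM := hs.notMem_marked_of_seen ha0 haS haM hza hz0
  have gw := gain_unseen (S := S) (M := M) hw hwS
  have ga := gain_unmarked (S₀ := S₀) (S := S) ha haM
  have gb := (hs.gain_touched hbN.2 (hs.symm hbN.1) hw).2 hbM
  have gc := (hs.gain_touched hcN.2 (hs.symm hcN.1) hw).2 hcM
  have gz := gain_unmarked (S₀ := S₀) (S := S) hz hzM
  have gb' : b ∉ U → gain U S₀ S M b = 15 := fun h =>
    gain_unseen (Finset.mem_sdiff.2 ⟨hbN.2, h⟩) hbS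
  have gc' : c ∉ U → gain U S₀ S M c = 15 := fun h =>
    gain_unseen (Finset.mem_sdiff.2 ⟨hcN.2, h⟩) hcS
  have hbU : ∀ p ∈ N b, p ∈ U₀ \ U → p ≠ w → b ∉ U := fun p hp hp' hpw hbU =>
    hpw ((hs.boundary hbU (hs.symm hbN.1) hw).2.2.2 p hp hp')
  have hcU : ∀ p ∈ N c, p ∈ U₀ \ U → p ≠ w → c ∉ U := fun p hp hp' hpw hcU =>
    hpw ((hs.boundary hcU (hs.symm hcN.1) hw).2.2.2 p hp hp')
  have hsum := hs.le_of_gain (l := [w, a, z, b, c])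
      (by simp [hwa, hwb, hwc, hab, hac, hbc, hzw.symm, hza'.symm, hzb, hzc])
      (by simp [hw0, ha0, hbN.2, hcN.2, hz0])
  have hsum' : ∀ s ∈ U₀, s ≠ w → s ≠ a → s ≠ z → s ≠ b → s ≠ c → _ := fun s hs0 h1 h2 h4 h5 h6 =>
    hs.le_of_gain (l := [w, a, z, b, c, s])
      (by simp [hwa, hwb, hwc, hab, hac, hbc, hzw.symm, hza'.symm, hzb, hzc, h1.symm, h2.symm,
        h4.symm, h5.symm, h6.symm])
      (by simp [hw0, ha0, hbN.2, hcN.2, hz0, hs0])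
  simp only [List.map_cons, List.map_nil, List.sum_cons, List.sum_nil] at hsum hsum'
  obtain ⟨s, hsz, hsa⟩ := hs.exists_other hz0 a
  obtain ⟨hsz, hs0⟩ := Finset.mem_inter.1 hsz
  have hsw : s ≠ w := fun e => hzN (hs.symm (e ▸ hsz))
  have hszn := (hs.ne_of_mem hsz).symm
  have gs := (hs.gain_touched hs0 (hs.symm hsz) hz).1
  -- The number 18 is 7 + 7 + 4 for `b`, `c` and the second neighbor `s` of `z`. If `s` is `b` or
  -- `c`, then that vertex lost two neighbors, so it was processed and counts 15.
  have gsum : totalWeight U S M + (gain U S₀ S M w + gain U S₀ S M a + gain U S₀ S M z) + 18 ≤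
      totalWeight U₀ S₀ M := by
    by_cases hsb : s = b
    · have := gb' (hbU z (hs.symm (hsb ▸ hsz)) hz hzw)
      omega
    by_cases hsc : s = c
    · have := gc' (hcU z (hs.symm (hsc ▸ hsz)) hz hzw)
      omega
    have := hsum' s hs0 hsw hsa hszn hsb hsc
    omega
  refine ⟨by omega, ?_⟩
  by_cases hzS : z ∈ S₀
  swap
  · have := gain_unseen (S := S) (M := M) hz hzS
    omega
  by_cases hk : ∀ k ∈ U₀ \ U, k ∈ S₀ → k ∉ M → k = a ∨ k = z
  · exact Or.inr ⟨hzS, hk⟩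
  left
  push Not at hk
  obtain ⟨k, hk, hkS, hkM, hka, hkz⟩ := hk
  have hk0 := (Finset.mem_sdiff.1 hk).1
  have gk := gain_unmarked (S₀ := S₀) (S := S) hk hkM
  have hkw : k ≠ w := fun e => hwS (e ▸ hkS)
  have hkb : k ≠ b := fun e => hbS (e ▸ hkS)
  have hkc : k ≠ c := fun e => hcS (e ▸ hkS)
  have hsumk := hsum' k hk0 hkw hka hkz hkb hkc
  -- With `k` the sum is 15 + 8 + 8 + 8 + 7 + 7 = 53. A neighbor of `k` other than `z` adds at least
  -- 4, or raises `b` or `c` from 7 to 15.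
  obtain ⟨t, htk, htz⟩ := hs.exists_other hk0 z
  obtain ⟨htk, ht0⟩ := Finset.mem_inter.1 htk
  have htw : t ≠ w := fun e => by
    have := (hmem k).1 (Finset.mem_inter.2 ⟨hs.symm (e ▸ htk), hk0⟩)
    tauto
  have hta : t ≠ a := fun e => by
    have := eq_of_card_two (hs.card_seen a ha0 haS) (Finset.mem_inter.2 ⟨hs.symm haN.1, hw0⟩)
      (Finset.mem_inter.2 ⟨hza, hz0⟩) hzw.symm
      (Finset.mem_inter.2 ⟨hs.symm (e ▸ htk), hk0⟩)
    tauto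
  have htkn := (hs.ne_of_mem htk).symm
  by_cases htb : t = b
  · have := gb' (hbU k (hs.symm (htb ▸ htk)) hk hkw)
    omega
  by_cases htc : t = c
  · have := gc' (hcU k (hs.symm (htc ▸ htk)) hk hkw)
    omega
  have gt := (hs.gain_touched ht0 (hs.symm htk) hk).1
  have hsum := hs.le_of_gain (l := [w, a, z, b, c, k, t])
      (by simp [hwa, hwb, hwc, hab, hac, hbc, hzw.symm, hza'.symm, hzb, hzc, htw.symm, hta.symm,
        htkn.symm, hkw.symm, hka.symm, hkb.symm, hkc.symm, hkz.symm, htz.symm, Ne.symm htb,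
        Ne.symm htc])
      (by simp [hw0, ha0, hbN.2, hcN.2, hz0, hk0, ht0])
  simp only [List.map_cons, List.map_nil, List.sum_cons, List.sum_nil] at hsum
  omega

/-- The loss of weight if a vertex that has not been seen is processed. -/
theorem gain_single (hw : w ∈ U₀ \ U) (hwS : w ∉ S₀) :
    totalWeight U S M + 15 ≤ totalWeight U₀ S₀ M := by
  have gw := gain_unseen (S := S) (M := M) hw hwS
  have := hs.le_of_gain (l := [w]) (by simp) (by simp [(Finset.mem_sdiff.1 hw).1])
  simp only [List.map_cons, List.map_nil, List.sum_cons, List.sum_nil] at this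
  omega

/-- The loss of weight if a vertex of degree three is processed. -/
theorem gain_star (hw : w ∈ U₀ \ U) (hwS : w ∉ S₀) (hN : N w ∩ U₀ = {a, b, c}) (hab : a ≠ b)
    (hac : a ≠ c) (hbc : b ≠ c) : totalWeight U S M + 36 ≤ totalWeight U₀ S₀ M := by
  have hw0 := (Finset.mem_sdiff.1 hw).1
  have h3 : (N w ∩ U₀).card = 3 := by rw [hN]; exact Finset.card_eq_three.2 ⟨a, b, c, hab, hac, hbc, rfl⟩
  have hmem : ∀ x, x ∈ N w ∩ U₀ ↔ x = a ∨ x = b ∨ x = c := by intro x; rw [hN]; simp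
  have hne : ∀ x ∈ N w ∩ U₀, w ≠ x := fun x hx =>
    hs.ne_of_mem (Finset.mem_inter.1 hx).1
  have hg : ∀ x ∈ N w ∩ U₀, 7 ≤ gain U S₀ S M x := fun x hx => by
    obtain ⟨h1, h2⟩ := Finset.mem_inter.1 hx
    exact (hs.gain_touched h2 (hs.symm h1) hw).2 (hs.notMem_marked hw0 h1 h2 h3)
  have hU : ∀ x ∈ N w ∩ U₀, x ∈ U₀ := fun x hx => (Finset.mem_inter.1 hx).2
  have ma := (hmem a).2 (by simp)
  have mb := (hmem b).2 (by simp)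
  have mc := (hmem c).2 (by simp)
  have gw := gain_unseen (S := S) (M := M) hw hwS
  have ga := hg a ma
  have gb := hg b mb
  have gc := hg c mc
  have := hs.le_of_gain (l := [w, a, b, c])
      (by simp [hne a ma, hne b mb, hne c mc, hab, hac, hbc])
      (by simp [hw0, hU a ma, hU b mb, hU c mc])
  simp only [List.map_cons, List.map_nil, List.sum_cons, List.sum_nil] at this
  omega

end Shrink

end Weight

/-! ### The number of advice bits -/

section Account

variable {L : Type*} [DecidableEq L] {W : Finset L} {G : SimpleGraph L} {h h₀ : History L}
  {b b₀ : ℕ} {v w : L} {d₀ : Bool} {M : Finset L}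

theorem inter_unproc (W : Finset L) (G : SimpleGraph L) (h : History L) (v : L) :
    nbrs W G v ∩ unproc W h = nbrs W G v \ processed h := by
  ext u
  have : u ∈ nbrs W G v → u ∈ W := fun hu => nbrs_subset W G v hu
  simp only [Finset.mem_inter, Finset.mem_sdiff]
  tauto

theorem card_inter_unproc (W : Finset L) (G : SimpleGraph L) (h : History L) (v : L) :
    (nbrs W G v ∩ unproc W h).card = curDeg h (item W G v) := by
  rw [inter_unproc]; rfl

theorem mem_unproc : v ∈ unproc W h ↔ v ∈ W ∧ v ∉ processed h := Finset.mem_sdiff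

/-- The marked vertices have been seen; their neighbors have degree two, and have not been seen
unless they are marked. -/
def MarkInv (W : Finset L) (G : SimpleGraph L) (h : History L) (M : Finset L) : Prop :=
  M ⊆ seen h ∧ ∀ m ∈ M, m ∈ unproc W h → ∀ y ∈ nbrs W G m ∩ unproc W h,
    curDeg h (item W G y) = 2 ∧ (y ∈ seen h → y ∈ M)

/-- The seen vertices that are not marked. -/
abbrev unmarked (W : Finset L) (h : History L) (M : Finset L) : Finset L :=
  (unproc W h ∩ seen h) \ M

/-- A debt of `d` is backed by the unmarked vertices. -/
def Debt (W : Finset L) (h : History L) (M : Finset L) (d : ℕ) : Prop :=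
  d = 0 ∨ ∃ p ∈ (memory h).1, unmarked W h M ⊆ p.2 ∧
    (d = 10 ∧ (unmarked W h M).card = 3 ∨ d = 3 ∧ (unmarked W h M).card = 2)

/-- Apart from a debt, each bit that has been read is paid for by a loss of weight of 46. -/
def Account (W : Finset L) (G : SimpleGraph L) (h : History L) (b : ℕ) : Prop :=
  ∃ M d, MarkInv W G h M ∧ Debt W h M d ∧
    46 * b + totalWeight (unproc W h) (seen h) M ≤ 15 * W.card + d

/-- Marking the backing vertices releases 4 for each: 12 covers 10, and 8 covers 3. -/
theorem Debt.le {d : ℕ} (hd : Debt W h M d) : d ≤ 4 * (unmarked W h M).card := by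
  rcases hd with rfl | ⟨p, -, -, ⟨rfl, h1⟩ | ⟨rfl, h1⟩⟩ <;> omega

theorem four_mul_card_le (U S M : Finset L) : 4 * U.card ≤ totalWeight U S M := by
  rw [mul_comm, ← smul_eq_mul]
  exact Finset.card_nsmul_le_sum _ _ _ fun x _ => four_le_weight S M x

/-- The debt never exceeds the weight that is still left, so it can be ignored in the final count.
-/
theorem Account.le (ha : Account W G h b) : 46 * b ≤ 15 * W.card := by
  obtain ⟨M, d, -, hd, hle⟩ := ha
  have h1 := hd.le
  have h2 := four_mul_card_le (unproc W h) (seen h) M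
  have h3 : (unmarked W h M).card ≤ (unproc W h).card :=
    Finset.card_le_card (Finset.sdiff_subset.trans Finset.inter_subset_left)
  omega

theorem account_zero (W : Finset L) (G : SimpleGraph L) (h : History L) : Account W G h 0 := by
  refine ⟨∅, 0, ⟨by simp, by simp⟩, Or.inl rfl, ?_⟩
  have h1 : totalWeight (unproc W h) (seen h) ∅ ≤ (unproc W h).card • 15 :=
    Finset.sum_le_card_nsmul _ _ _ fun x _ => by unfold weight; split_ifs <;> omega
  have h2 : (unproc W h).card ≤ W.card := Finset.card_le_card Finset.sdiff_subset
  simp only [smul_eq_mul] at h1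
  omega

theorem totalWeight_mark (U S M : Finset L) :
    totalWeight U S (U ∩ S) + 4 * ((U ∩ S) \ M).card ≤ totalWeight U S M := by
  have h1 : 4 * ((U ∩ S) \ M).card = ∑ x ∈ U, if x ∈ (U ∩ S) \ M then 4 else 0 := by
    rw [Finset.sum_ite_mem, Finset.inter_eq_right.2
      (Finset.sdiff_subset.trans Finset.inter_subset_left), Finset.sum_const, smul_eq_mul, mul_comm]
  unfold totalWeight
  rw [h1, ← Finset.sum_add_distrib]
  refine Finset.sum_le_sum fun x hx => ?_
  by_cases h2 : x ∈ S <;> by_cases h3 : x ∈ M <;> simp [weight, hx, h2, h3]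

/-- If no neighbor of the next vertex has been seen, then all seen vertices can be marked. -/
theorem markInv_all (hG : ∀ u v, G.Adj u v → u ∈ W ∧ v ∈ W)
    (hdeg : ∀ v ∈ W, (nbrs W G v).card ≤ 3) (hq : Quiet W G h) (hm : (memory h).2 = false)
    (ht : IsTop W G h w) (hk : kind h (item W G w) = .degThree)
    (hw : ¬ (nbrs W G w ∩ seen h).Nonempty) : MarkInv W G h (unproc W h ∩ seen h) := by
  refine ⟨Finset.inter_subset_right, fun m hmM hmU y hy => ?_⟩
  obtain ⟨hy, hyU⟩ := Finset.mem_inter.1 hy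
  refine ⟨?_, fun hyS => Finset.mem_inter.2 ⟨hyU, hyS⟩⟩
  have h1 := (hq y hyU).2.1
  have h2 := curDeg_le (G := G) (h := h) hdeg (mem_unproc.1 hyU).1
  by_contra hne
  have hky := hq.kind_degThree hm hyU (by omega)
  have h3 := ht.2 y hyU
  -- A neighbor shared with an advised vertex would have been seen.
  have hc : maxCommon (memory h).1 (item W G w) = 0 := by
    by_contra hc
    obtain ⟨p, hp, he⟩ := exists_maxCommon (Nat.pos_of_ne_zero hc)
    have h4 : 0 < ((item W G w).2 ∩ p.2).card := by omega
    obtain ⟨u, hu⟩ := Finset.card_pos.1 h4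
    obtain ⟨hu1, hu2⟩ := Finset.mem_inter.1 hu
    exact hw ⟨u, Finset.mem_inter.2 ⟨hu1, mem_seen.2 ⟨_, mem_of_mem_memory hp, hu2⟩⟩⟩
  rw [priorityValue_degThree hk, hc, if_neg (by omega), if_neg hw, priorityValue_degThree hky] at h3
  -- A neighbor of degree three of a seen vertex would have priority at least 2, but the received
  -- vertex has priority 1.
  have h5 : ((item W G y).2 ∩ seen h).Nonempty :=
    ⟨m, Finset.mem_inter.2 ⟨(mem_nbrs_comm hG).1 hy, (Finset.mem_inter.1 hmM).2⟩⟩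
  rw [if_pos h5] at h3
  split_ifs at h3 <;> omega

/-- Marking every seen vertex releases enough weight to cancel the debt. -/
theorem Account.mark (hG : ∀ u v, G.Adj u v → u ∈ W ∧ v ∈ W)
    (hdeg : ∀ v ∈ W, (nbrs W G v).card ≤ 3) (hq : Quiet W G h) (hm : (memory h).2 = false)
    (ht : IsTop W G h w) (hk : kind h (item W G w) = .degThree)
    (hw : ¬ (nbrs W G w ∩ seen h).Nonempty) (ha : Account W G h b) :
    MarkInv W G h (unproc W h ∩ seen h) ∧
      46 * b + totalWeight (unproc W h) (seen h) (unproc W h ∩ seen h) ≤ 15 * W.card := by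
  refine ⟨markInv_all hG hdeg hq hm ht hk hw, ?_⟩
  obtain ⟨M, d, -, hd, hle⟩ := ha
  have h1 : d ≤ 4 * ((unproc W h ∩ seen h) \ M).card := hd.le
  have h2 := totalWeight_mark (unproc W h) (seen h) M
  omega

theorem processed_mono {l l' : History L} (hl : l <:+ l') : processed l ⊆ processed l' := by
  intro v hv
  obtain ⟨p, hp, e⟩ := mem_processed.1 hv
  exact mem_processed.2 ⟨p, hl.subset hp, e⟩

theorem accepted_mono {l l' : History L} (hl : l <:+ l') : accepted l ⊆ accepted l' := by
  intro v hv
  obtain ⟨p, hp, e⟩ := mem_accepted.1 hv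
  exact mem_accepted.2 ⟨p, hl.subset hp, e⟩

theorem rejected_mono {l l' : History L} (hl : l <:+ l') : rejected l ⊆ rejected l' := by
  intro v hv
  obtain ⟨p, hp, e⟩ := mem_rejected.1 hv
  exact mem_rejected.2 ⟨p, hl.subset hp, e⟩

theorem seen_mono {l l' : History L} (hl : l <:+ l') : seen l ⊆ seen l' := by
  intro v hv
  obtain ⟨p, hp, e⟩ := mem_seen.1 hv
  exact mem_seen.2 ⟨p, hl.subset hp, e⟩

theorem unproc_anti {l l' : History L} (hl : l <:+ l') : unproc W l' ⊆ unproc W l :=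
  Finset.sdiff_subset_sdiff le_rfl (processed_mono hl)

theorem unproc_sdiff (hr : Reach W G h b) :
    unproc W h₀ \ unproc W h = processed h \ processed h₀ := by
  ext x
  have := @Reach.processed_subset L _ W G h b hr x
  simp only [unproc, Finset.mem_sdiff]
  tauto

/-- Quietness at both ends provides the minimum degree two; a seen vertex has lost a neighbor, so
its degree is exactly two. -/
theorem shrink_of_quiet (hG : ∀ u v, G.Adj u v → u ∈ W ∧ v ∈ W)
    (hdeg : ∀ v ∈ W, (nbrs W G v).card ≤ 3) (hr₀ : Reach W G h₀ b₀) (hr : Reach W G h b)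
    (hl : h₀ <:+ h) (hq₀ : Quiet W G h₀) (hq : Quiet W G h) (hM : MarkInv W G h₀ M) :
    Shrink (nbrs W G) (unproc W h₀) (unproc W h) (seen h₀) (seen h) M where
  symm := fun hxy => (mem_nbrs_comm hG).1 hxy
  irrefl := fun x => notMem_nbrs_self hG
  subset := unproc_anti hl
  two_le := fun x hx => by rw [card_inter_unproc]; exact (hq₀ x hx).2.1
  le_three := fun x hx => by rw [card_inter_unproc]; exact curDeg_le hdeg (mem_unproc.1 hx).1
  card_seen := fun x hx hxS => by
    have h1 := (hq₀ x hx).2.1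
    have h2 := curDeg_le (G := G) (h := h₀) hdeg (mem_unproc.1 hx).1
    rw [card_inter_unproc]
    by_contra hne
    obtain ⟨h3, -⟩ := nbrs_of_curDeg_eq_three hdeg (mem_unproc.1 hx).1
      (show curDeg h₀ (item W G x) = 3 by omega)
    obtain ⟨u, hu⟩ := (hr₀.mem_seen_iff hG).1 hxS
    obtain ⟨hu1, hu2⟩ := Finset.mem_inter.1 hu
    exact Finset.disjoint_left.1 h3 hu1 hu2
  two_le' := fun x hx => by rw [card_inter_unproc]; exact (hq x hx).2.1
  seen_iff := fun x hx => by
    rw [hr.mem_seen_iff hG, hr₀.mem_seen_iff hG, unproc_sdiff hr, ← Finset.union_nonempty,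
      ← Finset.inter_union_distrib_left, Finset.union_sdiff_of_subset (processed_mono hl)]
  marked_seen := hM.1
  marked := fun m hm hmU y hy => by
    rw [card_inter_unproc]; exact hM.2 m hm hmU y hy

/-- The neighbors of a marked vertex had degree two and, if unprocessed, still do. So they lost no
neighbor in between, and none of them became seen. -/
theorem MarkInv.of_suffix (hG : ∀ u v, G.Adj u v → u ∈ W ∧ v ∈ W) (hr₀ : Reach W G h₀ b₀)
    (hr : Reach W G h b) (hl : h₀ <:+ h) (hq : Quiet W G h) (hM : MarkInv W G h₀ M) :
    MarkInv W G h M := by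
  refine ⟨hM.1.trans (seen_mono hl), fun m hm hmU y hy => ?_⟩
  obtain ⟨hy, hyU⟩ := Finset.mem_inter.1 hy
  obtain ⟨h1, h2⟩ := hM.2 m hm (unproc_anti hl hmU) y (Finset.mem_inter.2 ⟨hy, unproc_anti hl hyU⟩)
  have h3 := (hq y hyU).2.1
  have hsub : nbrs W G y \ processed h ⊆ nbrs W G y \ processed h₀ :=
    Finset.sdiff_subset_sdiff le_rfl (processed_mono hl)
  have heq : nbrs W G y \ processed h = nbrs W G y \ processed h₀ :=
    Finset.eq_of_subset_of_card_le hsub (by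
      change curDeg h₀ (item W G y) ≤ curDeg h (item W G y); omega)
  refine ⟨?_, fun hyS => h2 ?_⟩
  · rw [← h1]; exact congrArg Finset.card heq
  · rw [hr.mem_seen_iff hG] at hyS
    rw [hr₀.mem_seen_iff hG]
    obtain ⟨u, hu⟩ := hyS
    obtain ⟨hu1, hu2⟩ := Finset.mem_inter.1 hu
    refine ⟨u, Finset.mem_inter.2 ⟨hu1, ?_⟩⟩
    by_contra hu3
    have : u ∈ nbrs W G y \ processed h := by
      rw [heq]; exact Finset.mem_sdiff.2 ⟨hu1, hu3⟩
    exact (Finset.mem_sdiff.1 this).2 hu2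

/-- After the history `h₀`, the vertex `w` of current degree three was processed, followed by
vertices of kinds of high priority. -/
structure Segment (W : Finset L) (G : SimpleGraph L) (h₀ : History L) (w : L) (d₀ : Bool)
    (h : History L) : Prop where
  quiet : Quiet W G h₀
  memory_snd : (memory h₀).2 = false
  top : IsTop W G h₀ w
  kind_eq : kind h₀ (item W G w) = .degThree
  suffix : (item W G w, d₀) :: h₀ <:+ h
  memory_subset : (memory ((item W G w, d₀) :: h₀)).1 ⊆ (memory h).1
  hasRej : ∀ x ∈ accepted h, x ∉ processed h₀ → x ≠ w → HasRej W G h x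

theorem mem_accepted_of_adj (hG : ∀ u v, G.Adj u v → u ∈ W ∧ v ∈ W)
    (hex : ∃ T, OptExt W G h T) {x y : L} (hx : x ∈ processed h) (hy : y ∈ processed h)
    (hxy : y ∈ nbrs W G x) : x ∈ accepted h ∨ y ∈ accepted h := by
  obtain ⟨T, hT⟩ := hex
  rw [processed_eq] at hx hy
  rcases Finset.mem_union.1 hx with hx | hx
  · exact Or.inl hx
  rcases Finset.mem_union.1 hy with hy | hy
  · exact Or.inr hy
  exact absurd (hT.cover ((mem_nbrs hG).1 hxy))
    (not_or.2 ⟨hT.notMem_of_rejected hx, hT.notMem_of_rejected hy⟩)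

theorem Quiet.notMem_of_sibling (hq : Quiet W G h) {p : Item L} (hp : p ∈ (memory h).1) {x y : L}
    (hx : x ∈ p.2) (hxa : x ∈ accepted h) (hy : y ∈ p.2) : y ∉ unproc W h := fun hyU =>
  (hq y hyU).2.2 ⟨p, hp, hy, x, Finset.mem_inter.2 ⟨hx, hxa⟩⟩

/-! ### Forced vertices after a vertex of degree three -/

namespace Segment

variable (hs : Segment W G h₀ w d₀ h)
include hs

theorem suffix' : h₀ <:+ h := (List.suffix_cons _ _).trans hs.suffix

theorem mem_processed : w ∈ processed h :=
  processed_mono hs.suffix (by simp)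

theorem mem_sdiff : w ∈ unproc W h₀ \ unproc W h :=
  Finset.mem_sdiff.2 ⟨hs.top.1, fun h' => (mem_unproc.1 h').2 hs.mem_processed⟩

theorem notMem_seen (hG : ∀ u v, G.Adj u v → u ∈ W ∧ v ∈ W)
    (hdeg : ∀ v ∈ W, (nbrs W G v).card ≤ 3) (hr₀ : Reach W G h₀ b₀) : w ∉ seen h₀ := by
  intro hw
  obtain ⟨u, hu⟩ := (hr₀.mem_seen_iff hG).1 hw
  obtain ⟨hu1, hu2⟩ := Finset.mem_inter.1 hu
  exact Finset.disjoint_left.1 (nbrs_of_curDeg_eq_three hdeg (mem_unproc.1 hs.top.1).1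
    (curDeg_of_kind_degThree hs.kind_eq)).1 hu1 hu2

theorem card_eq : (nbrs W G w ∩ unproc W h₀).card = 3 := by
  rw [card_inter_unproc]; exact curDeg_of_kind_degThree hs.kind_eq

theorem exists_eq {a : L} (ha : a ∈ nbrs W G w ∩ unproc W h₀) :
    ∃ b c, nbrs W G w ∩ unproc W h₀ = {a, b, c} ∧ a ≠ b ∧ a ≠ c ∧ b ≠ c := by
  have h1 := Finset.card_erase_of_mem ha
  rw [hs.card_eq] at h1
  obtain ⟨b, c, hbc, he⟩ := Finset.card_eq_two.1 h1
  have hb : b ∈ (nbrs W G w ∩ unproc W h₀).erase a := by rw [he]; simp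
  have hc : c ∈ (nbrs W G w ∩ unproc W h₀).erase a := by rw [he]; simp
  refine ⟨b, c, ?_, (Finset.ne_of_mem_erase hb).symm, (Finset.ne_of_mem_erase hc).symm, hbc⟩
  rw [← he, Finset.insert_erase ha]

/-- The neighbors of a rejected vertex are processed. -/
theorem nbr_mem_sdiff_of_rejected (hG : ∀ u v, G.Adj u v → u ∈ W ∧ v ∈ W) (hq : Quiet W G h)
    (hd : d₀ = false) {x : L} (hx : x ∈ nbrs W G w ∩ unproc W h₀) :
    x ∈ unproc W h₀ \ unproc W h := by
  obtain ⟨h1, h2⟩ := Finset.mem_inter.1 hx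
  refine Finset.mem_sdiff.2 ⟨h2, fun h3 => (hq x h3).1 ⟨w, Finset.mem_inter.2
    ⟨(mem_nbrs_comm hG).1 h1, rejected_mono hs.suffix (by simp [hd])⟩⟩⟩

/-- If a neighbor of degree two of the accepted vertex `w` is processed, then so is its other
neighbor. -/
theorem other_mem_sdiff (hG : ∀ u v, G.Adj u v → u ∈ W ∧ v ∈ W) (hq : Quiet W G h)
    (hex : ∃ T, OptExt W G h T) (hd : d₀ = true) {a z : L} (haN : a ∈ nbrs W G w)
    (ha : a ∈ unproc W h₀ \ unproc W h)
    (ha2 : (nbrs W G a ∩ unproc W h₀).card = 2) (hz : z ∈ nbrs W G a ∩ unproc W h₀)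
    (hzw : z ≠ w) : z ∈ unproc W h₀ \ unproc W h := by
  obtain ⟨T, hT⟩ := hex
  obtain ⟨haU, haU'⟩ := Finset.mem_sdiff.1 ha
  obtain ⟨hzN, hzU⟩ := Finset.mem_inter.1 hz
  have hwT : w ∈ T := hT.accepted_subset (accepted_mono hs.suffix (by simp [hd]))
  have hap : a ∈ processed h := by
    by_contra hap
    exact haU' (mem_unproc.2 ⟨(mem_unproc.1 haU).1, hap⟩)
  refine Finset.mem_sdiff.2 ⟨hzU, fun hzU' => ?_⟩
  rw [processed_eq] at hap
  -- If `a` was accepted, it has a rejected neighbor, unprocessed at `h₀`; it is not the accepted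
  -- `w`, so it is `z`. If `a` was rejected, then `z` is forced by rule 1.
  rcases Finset.mem_union.1 hap with hap | hap
  · have haw : a ≠ w := fun e => notMem_nbrs_self (W := W) (G := G) hG (by rw [e] at haN; exact haN)
    obtain ⟨r, hr⟩ := hs.hasRej a hap (mem_unproc.1 haU).2 haw
    obtain ⟨hr1, hr2⟩ := Finset.mem_inter.1 hr
    have hrT := hT.notMem_of_rejected hr2
    have hr0 : r ∉ processed h₀ := by
      rw [processed_eq]
      intro h1
      rcases Finset.mem_union.1 h1 with h1 | h1
      · exact hrT (hT.accepted_subset (accepted_mono hs.suffix' h1))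
      · exact (hs.quiet a haU).1 ⟨r, Finset.mem_inter.2 ⟨hr1, h1⟩⟩
    have hrU : r ∈ nbrs W G a ∩ unproc W h₀ :=
      Finset.mem_inter.2 ⟨hr1, mem_unproc.2 ⟨nbrs_subset W G a hr1, hr0⟩⟩
    have hwU : w ∈ nbrs W G a ∩ unproc W h₀ :=
      Finset.mem_inter.2 ⟨(mem_nbrs_comm hG).1 haN, hs.top.1⟩
    rcases Shrink.eq_of_card_two ha2 hwU hz hzw.symm hrU with rfl | rfl
    · exact hrT hwT
    · exact (mem_unproc.1 hzU').2 (rejected_subset_processed h hr2)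
  · exact (hq z hzU').1 ⟨a, Finset.mem_inter.2 ⟨(mem_nbrs_comm hG).1 hzN, hap⟩⟩

/-- If two neighbors of an advised vertex are adjacent and processed, then all its neighbors are
processed. -/
theorem nbr_mem_sdiff_of_adj (hG : ∀ u v, G.Adj u v → u ∈ W ∧ v ∈ W) (hr : Reach W G h b)
    (hq : Quiet W G h)
    (hex : ∃ T, OptExt W G h T) {p : Item L} (hp : p ∈ (memory h).1) {a z : L} (hap : a ∈ p.2)
    (hzp : z ∈ p.2) (ha : a ∈ unproc W h₀ \ unproc W h) (hz : z ∈ unproc W h₀ \ unproc W h)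
    (hza : z ∈ nbrs W G a) {x : L} (hx : x ∈ p.2) (hxU : x ∈ unproc W h₀) :
    x ∈ unproc W h₀ \ unproc W h := by
  refine Finset.mem_sdiff.2 ⟨hxU, ?_⟩
  rw [unproc_sdiff hr] at ha hz
  -- One end of the edge is accepted, so rule 4 forces the remaining neighbors of the advised
  -- vertex.
  rcases mem_accepted_of_adj hG hex (Finset.mem_sdiff.1 ha).1 (Finset.mem_sdiff.1 hz).1 hza with
    h1 | h1
  · exact hq.notMem_of_sibling hp hap h1 hx
  · exact hq.notMem_of_sibling hp hzp h1 hx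

/-- A neighbor of degree two of `w` is processed. -/
theorem mem_sdiff_of_card_two {M : Finset L}
    (hsh : Shrink (nbrs W G) (unproc W h₀) (unproc W h) (seen h₀) (seen h) M) {a : L}
    (ha : a ∈ nbrs W G w ∩ unproc W h₀) (ha2 : (nbrs W G a ∩ unproc W h₀).card = 2) :
    a ∈ unproc W h₀ \ unproc W h := by
  obtain ⟨h1, h2⟩ := Finset.mem_inter.1 ha
  refine Finset.mem_sdiff.2 ⟨h2, fun h3 => ?_⟩
  have := (hsh.boundary h3 (hsh.symm h1) hs.mem_sdiff).1
  omega

theorem item_mem_memory (hn : NeedsAdvice h₀ (item W G w)) (hd : d₀ = true) :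
    item W G w ∈ (memory h).1 := by
  refine hs.memory_subset ?_
  rw [memory_fst_cons_degThree hs.kind_eq, if_pos ⟨hd, hn.2⟩]
  simp

/-- In general, a bit is paid for by the vertices that are processed thereafter. -/
theorem gain_advice (hG : ∀ u v, G.Adj u v → u ∈ W ∧ v ∈ W)
    (hdeg : ∀ v ∈ W, (nbrs W G v).card ≤ 3) (hr₀ : Reach W G h₀ b₀) (hr : Reach W G h b)
    (hq : Quiet W G h) (hex : ∃ T, OptExt W G h T) (hn : NeedsAdvice h₀ (item W G w))
    (hstart : d₀ = true → ∃ x ∈ nbrs W G w, curDeg h₀ (item W G x) ≠ 3)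
    (hM : MarkInv W G h₀ M) :
    totalWeight (unproc W h) (seen h) M + 46 ≤ totalWeight (unproc W h₀) (seen h₀) M := by
  have hsh := shrink_of_quiet hG hdeg hr₀ hr hs.suffix' hs.quiet hq hM
  have hwS := hs.notMem_seen hG hdeg hr₀
  have hmem : ∀ {a b c : L}, nbrs W G w ∩ unproc W h₀ = {a, b, c} →
      a ∈ nbrs W G w ∩ unproc W h₀ ∧ b ∈ nbrs W G w ∩ unproc W h₀ ∧
        c ∈ nbrs W G w ∩ unproc W h₀ := fun e => by rw [e]; simp
  cases hd : d₀
  · obtain ⟨a, ha⟩ := Finset.card_pos.1 (by rw [hs.card_eq]; omega)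
    obtain ⟨b, c, he, hab, hac, hbc⟩ := hs.exists_eq ha
    obtain ⟨h1, h2, h3⟩ := hmem he
    exact hsh.gain_closed hs.mem_sdiff hwS he hab hac hbc (hs.nbr_mem_sdiff_of_rejected hG hq hd h1)
      (hs.nbr_mem_sdiff_of_rejected hG hq hd h2) (hs.nbr_mem_sdiff_of_rejected hG hq hd h3)
  · obtain ⟨a, haN, ha3⟩ := hstart hd
    obtain ⟨hdis, -⟩ := nbrs_of_curDeg_eq_three hdeg (mem_unproc.1 hs.top.1).1
      (curDeg_of_kind_degThree hs.kind_eq)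
    have haU : a ∈ unproc W h₀ :=
      mem_unproc.2 ⟨nbrs_subset W G w haN, Finset.disjoint_left.1 hdis haN⟩
    have ha := Finset.mem_inter.2 ⟨haN, haU⟩
    have ha2 : (nbrs W G a ∩ unproc W h₀).card = 2 := by
      have h1 := hsh.two_le a haU
      have h2 := hsh.le_three a haU
      rw [← card_inter_unproc] at ha3
      omega
    have haP := hs.mem_sdiff_of_card_two hsh ha ha2
    obtain ⟨b, c, he, hab, hac, hbc⟩ := hs.exists_eq ha
    obtain ⟨z, hz, hzw⟩ := hsh.exists_other haU w
    have hzP := hs.other_mem_sdiff hG hq hex hd haN haP ha2 hz hzw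
    obtain ⟨hza, hzU⟩ := Finset.mem_inter.1 hz
    -- If `a` lies in a triangle with `w`, rule 4 forces the third neighbor of `w` too.
    by_cases hzN : z ∈ nbrs W G w
    · obtain ⟨h1, h2, h3⟩ := hmem he
      have key : ∀ x ∈ nbrs W G w ∩ unproc W h₀, x ∈ unproc W h₀ \ unproc W h := fun x hx =>
        hs.nbr_mem_sdiff_of_adj hG hr hq hex (hs.item_mem_memory hn hd) haN hzN haP hzP hza
          (Finset.mem_inter.1 hx).1 (Finset.mem_inter.1 hx).2
      exact hsh.gain_closed hs.mem_sdiff hwS he hab hac hbc (key a h1) (key b h2) (key c h3)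
    · exact hsh.gain_path hs.mem_sdiff hwS he hab hac hbc haP hzP hza hzw hzN

/-- If there is a debt and a neighbor of `w` has been seen, then part of the debt is paid back. -/
theorem account_of_debt (hG : ∀ u v, G.Adj u v → u ∈ W ∧ v ∈ W)
    (hdeg : ∀ v ∈ W, (nbrs W G v).card ≤ 3) (hr₀ : Reach W G h₀ b₀) (hr : Reach W G h b)
    (hq : Quiet W G h) (hex : ∃ T, OptExt W G h T) (hn : NeedsAdvice h₀ (item W G w))
    (hM : MarkInv W G h₀ M) {p : Item L} (hp : p ∈ (memory h₀).1)
    (hK : unmarked W h₀ M ⊆ p.2) {d : ℕ}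
    (hd : d = 10 ∧ (unmarked W h₀ M).card = 3 ∨ d = 3 ∧ (unmarked W h₀ M).card = 2)
    (hle : 46 * b₀ + totalWeight (unproc W h₀) (seen h₀) M ≤ 15 * W.card + d)
    (hb : b = b₀ + 1) (hseen : (nbrs W G w ∩ seen h₀).Nonempty) : Account W G h b := by
  have hsh := shrink_of_quiet hG hdeg hr₀ hr hs.suffix' hs.quiet hq hM
  have hM' := hM.of_suffix hG hr₀ hr hs.suffix' hq
  have hwS := hs.notMem_seen hG hdeg hr₀
  have hph : p ∈ (memory h).1 := hs.memory_subset (memory_fst_subset_cons _ _ hp)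
  obtain ⟨a, ha⟩ := hseen
  obtain ⟨haN, haS⟩ := Finset.mem_inter.1 ha
  obtain ⟨hdis, -⟩ := nbrs_of_curDeg_eq_three hdeg (mem_unproc.1 hs.top.1).1
      (curDeg_of_kind_degThree hs.kind_eq)
  have haU : a ∈ unproc W h₀ :=
    mem_unproc.2 ⟨nbrs_subset W G w haN, Finset.disjoint_left.1 hdis haN⟩
  have ha := Finset.mem_inter.2 ⟨haN, haU⟩
  have ha2 := hsh.card_seen a haU haS
  have haP := hs.mem_sdiff_of_card_two hsh ha ha2
  obtain ⟨b', c, he, hab, hac, hbc⟩ := hs.exists_eq ha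
  have hmemK : ∀ x ∈ nbrs W G w ∩ unproc W h₀, x ∈ seen h₀ → x ∈ unmarked W h₀ M := fun x hx hxS =>
    Finset.mem_sdiff.2 ⟨Finset.mem_inter.2 ⟨(Finset.mem_inter.1 hx).2, hxS⟩,
      hsh.notMem_marked hs.top.1 (Finset.mem_inter.1 hx).1 (Finset.mem_inter.1 hx).2 hs.card_eq⟩
  have haK := hmemK a ha haS
  -- Seen neighbors of `w` are unmarked, hence neighbors of the advised vertex `p` that backs the
  -- debt. As a bit is read, `w` shares only one neighbor with `p`.
  have hone : ∀ x ∈ nbrs W G w ∩ unproc W h₀, a ≠ x → x ∉ seen h₀ := fun x hx hax hxS => by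
    have h1 := le_maxCommon hp (item W G w)
    have h2 := hn.2
    exact hax (Finset.card_le_one.1 (by omega : ((item W G w).2 ∩ p.2).card ≤ 1) a
      (Finset.mem_inter.2 ⟨haN, hK haK⟩) x
      (Finset.mem_inter.2 ⟨(Finset.mem_inter.1 hx).1, hK (hmemK x hx hxS)⟩))
  have hbm : b' ∈ nbrs W G w ∩ unproc W h₀ := by rw [he]; simp
  have hcm : c ∈ nbrs W G w ∩ unproc W h₀ := by rw [he]; simp
  have hbS := hone b' hbm hab
  have hcS := hone c hcm hac
  have hpay : totalWeight (unproc W h) (seen h) M + 46 + d ≤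
      totalWeight (unproc W h₀) (seen h₀) M → Account W G h b := fun h1 =>
    ⟨M, 0, hM', Or.inl rfl, by omega⟩
  have hclosed : (∀ x ∈ nbrs W G w ∩ unproc W h₀, x ∈ unproc W h₀ \ unproc W h) →
      Account W G h b := fun key => by
    obtain ⟨h1, h2⟩ := hsh.gain_closed_of_seen hs.mem_sdiff hwS he hab hac hbc (key a ha)
      (key b' hbm) (key c hcm) hbS hcS
    rcases hd with ⟨rfl, hc3⟩ | ⟨rfl, -⟩
    swap
    · exact hpay (by omega)
    rcases h2 with h2 | ⟨h2, h3⟩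
    · exact hpay (by omega)
    -- The loss is at least 53 = 46 + 7, so 3 of the debt of 10 may remain. Nothing else is
    -- affected, so exactly the two other backing vertices are still unmarked.
    have hKa : unmarked W h M = (unmarked W h₀ M).erase a := by
      ext x
      simp only [unmarked, Finset.mem_erase, Finset.mem_sdiff, Finset.mem_inter]
      constructor
      · rintro ⟨⟨hx1, hx2⟩, hx3⟩
        have hxU : x ∈ unproc W h := Finset.mem_sdiff.2 hx1
        refine ⟨fun e => (Finset.mem_sdiff.1 haP).2 (e ▸ hxU),
          ⟨Finset.mem_sdiff.1 (unproc_anti hs.suffix' hxU), h3 x hxU hx2⟩, hx3⟩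
      · rintro ⟨hxa, ⟨hx1, hx2⟩, hx3⟩
        have hxU : x ∈ unproc W h₀ := Finset.mem_sdiff.2 hx1
        refine ⟨⟨?_, seen_mono hs.suffix' hx2⟩, hx3⟩
        rw [← Finset.mem_sdiff]
        by_contra hxU'
        have := h2 (Finset.mem_sdiff.2 ⟨hxU, hxU'⟩)
        simp only [Finset.mem_insert, Finset.mem_singleton] at this
        rcases this with rfl | rfl | rfl | rfl
        exacts [hwS hx2, hxa rfl, hbS hx2, hcS hx2]
    refine ⟨M, 3, hM', Or.inr ⟨p, hph, ?_, Or.inr ⟨rfl, ?_⟩⟩, by omega⟩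
    · rw [hKa]; exact (Finset.erase_subset _ _).trans hK
    · rw [hKa, Finset.card_erase_of_mem haK]; omega
  cases hd0 : d₀
  · exact hclosed fun x hx => hs.nbr_mem_sdiff_of_rejected hG hq hd0 hx
  obtain ⟨z, hz, hzw⟩ := hsh.exists_other haU w
  have hzP := hs.other_mem_sdiff hG hq hex hd0 haN haP ha2 hz hzw
  obtain ⟨hza, hzU⟩ := Finset.mem_inter.1 hz
  by_cases hzN : z ∈ nbrs W G w
  · exact hclosed fun x hx =>
      hs.nbr_mem_sdiff_of_adj hG hr hq hex (hs.item_mem_memory hn hd0) haN hzN haP hzP hza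
        (Finset.mem_inter.1 hx).1 (Finset.mem_inter.1 hx).2
  obtain ⟨h1, h2⟩ := hsh.gain_path_of_seen hs.mem_sdiff hwS he hab hac hbc haP haS hbS hcS hzP hza
    hzw hzN
  rcases hd with ⟨rfl, hc3⟩ | ⟨rfl, -⟩
  swap
  · exact hpay (by omega)
  rcases h2 with h2 | ⟨hzS, h2⟩
  · exact hpay (by omega)
  -- Here `a` and `z` are adjacent neighbors of `p`, so rule 4 has forced all three backing
  -- vertices. But no seen unmarked vertex besides `a` and `z` was processed.
  exfalso
  have hzK : z ∈ unmarked W h₀ M := Finset.mem_sdiff.2 ⟨Finset.mem_inter.2 ⟨hzU, hzS⟩,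
    hsh.notMem_marked_of_seen haU haS (Finset.mem_sdiff.1 haK).2 hza hzU⟩
  have hsub : unmarked W h₀ M ⊆ {a, z} := fun k hk => by
    have hk' := Finset.mem_sdiff.1 hk
    obtain ⟨hkU, hkS⟩ := Finset.mem_inter.1 hk'.1
    have := h2 k (hs.nbr_mem_sdiff_of_adj hG hr hq hex hph (hK haK) (hK hzK) haP hzP hza (hK hk)
      hkU) hkS hk'.2
    simpa using this
  have := (Finset.card_le_card hsub).trans Finset.card_le_two
  omega

/-- The account at the end of a segment. -/
theorem account (hG : ∀ u v, G.Adj u v → u ∈ W ∧ v ∈ W)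
    (hdeg : ∀ v ∈ W, (nbrs W G v).card ≤ 3) (hr₀ : Reach W G h₀ b₀) (hr : Reach W G h b)
    (hq : Quiet W G h) (hex : ∃ T, OptExt W G h T) (ha : Account W G h₀ b₀)
    (hb : NeedsAdvice h₀ (item W G w) → b = b₀ + 1)
    (hb' : ¬ NeedsAdvice h₀ (item W G w) → b = b₀)
    (hstart : NeedsAdvice h₀ (item W G w) → d₀ = true →
      ∃ x ∈ nbrs W G w, curDeg h₀ (item W G x) ≠ 3) : Account W G h b := by
  by_cases hn : NeedsAdvice h₀ (item W G w)
  · by_cases hseen : (nbrs W G w ∩ seen h₀).Nonempty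
    · obtain ⟨M, d, hM, hd, hle⟩ := ha
      rcases hd with rfl | ⟨p, hp, hK, hd⟩
      · have := hs.gain_advice hG hdeg hr₀ hr hq hex hn (hstart hn) hM
        have := hb hn
        exact ⟨M, 0, hM.of_suffix hG hr₀ hr hs.suffix' hq, Or.inl rfl, by omega⟩
      · exact hs.account_of_debt hG hdeg hr₀ hr hq hex hn hM hp hK hd hle (hb hn) hseen
    · obtain ⟨hM, hle⟩ := ha.mark hG hdeg hs.quiet hs.memory_snd hs.top hs.kind_eq hseen
      have := hs.gain_advice hG hdeg hr₀ hr hq hex hn (hstart hn) hM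
      have := hb hn
      exact ⟨_, 0, hM.of_suffix hG hr₀ hr hs.suffix' hq, Or.inl rfl, by omega⟩
  · obtain ⟨M, d, hM, hd, hle⟩ := ha
    have hsh := shrink_of_quiet hG hdeg hr₀ hr hs.suffix' hs.quiet hq hM
    have := hsh.gain_single hs.mem_sdiff (hs.notMem_seen hG hdeg hr₀)
    have := hb' hn
    -- Without a bit to pay for, the loss of 15 for `w` alone cancels any debt.
    have hd' : d ≤ 10 := by
      rcases hd with rfl | ⟨p, -, -, ⟨rfl, -⟩ | ⟨rfl, -⟩⟩ <;> omega
    exact ⟨M, 0, hM.of_suffix hG hr₀ hr hs.suffix' hq, Or.inl rfl, by omega⟩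

end Segment

end Account

/-! ### The rounds before the cycles are processed -/

section Pre

variable {L : Type*} [DecidableEq L] {W : Finset L} {G : SimpleGraph L} {h h₀ : History L}
  {b b₀ : ℕ} {v w : L} {d : Bool}

/-- If there is advice to accept a vertex whose neighbors all have degree three, then the next
vertex has degree at least two again. -/
theorem quiet_of_start (hG : ∀ u v, G.Adj u v → u ∈ W ∧ v ∈ W)
    (hdeg : ∀ v ∈ W, (nbrs W G v).card ≤ 3) (hr₀ : Reach W G h₀ b₀) (hq₀ : Quiet W G h₀)
    (ht : IsTop W G h₀ w)
    (hn : NeedsAdvice h₀ (item W G w)) (h3 : ∀ x ∈ nbrs W G w, curDeg h₀ (item W G x) = 3) :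
    Quiet W G ((item W G w, true) :: h₀) := by
  have hwU := mem_unproc.1 ht.1
  obtain ⟨hdis, -⟩ := nbrs_of_curDeg_eq_three hdeg hwU.1 (curDeg_of_kind_degThree hn.1)
  intro v hv
  rw [mem_unproc, processed_cons, Finset.mem_insert, not_or] at hv
  obtain ⟨hvW, hvw, hvp⟩ := hv
  obtain ⟨h1, h2, h4⟩ := hq₀ v (mem_unproc.2 ⟨hvW, hvp⟩)
  refine ⟨by simpa [HasRej] using h1, ?_, ?_⟩
  · have e : nbrs W G v \ processed ((item W G w, true) :: h₀) =
        (nbrs W G v \ processed h₀).erase w := by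
      ext u
      simp only [processed_cons, Finset.mem_sdiff, Finset.mem_insert, Finset.mem_erase]
      tauto
    change 2 ≤ (nbrs W G v \ processed ((item W G w, true) :: h₀)).card
    change 2 ≤ (nbrs W G v \ processed h₀).card at h2
    rw [e]
    by_cases hw : w ∈ nbrs W G v
    · have h5 : (nbrs W G v \ processed h₀).card = 3 := h3 v ((mem_nbrs_comm hG).1 hw)
      have := Finset.pred_card_le_card_erase (s := nbrs W G v \ processed h₀) (a := w)
      omega
    · rwa [Finset.erase_eq_of_notMem (fun h' => hw (Finset.mem_sdiff.1 h').1)]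
  · rintro ⟨p, hp, hvp', u, hu⟩
    obtain ⟨hu1, hu2⟩ := Finset.mem_inter.1 hu
    rw [accepted_cons_true, Finset.mem_insert] at hu2
    rw [memory_fst_cons_degThree hn.1, if_pos ⟨rfl, hn.2⟩] at hp
    rcases List.mem_cons.1 hp with rfl | hpm
    · rcases hu2 with rfl | hu2
      · exact notMem_nbrs_self hG hu1
      · exact Finset.disjoint_left.1 hdis hu1 (accepted_subset_processed h₀ hu2)
    -- The new vertex is no neighbor of an earlier advised one, since it has no processed neighbor.
    · rcases hu2 with rfl | hu2
      · have hwS : u ∈ seen h₀ := mem_seen.2 ⟨_, mem_of_mem_memory hpm, hu1⟩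
        obtain ⟨r, hr⟩ := (hr₀.mem_seen_iff hG).1 hwS
        obtain ⟨hr1, hr2⟩ := Finset.mem_inter.1 hr
        exact Finset.disjoint_left.1 hdis hr1 hr2
      · exact h4 ⟨p, hpm, hvp', u, Finset.mem_inter.2 ⟨hu1, hu2⟩⟩

/-- A bit that is read for a vertex whose neighbors all have degree three results in a debt. -/
theorem account_of_start (hG : ∀ u v, G.Adj u v → u ∈ W ∧ v ∈ W)
    (hdeg : ∀ v ∈ W, (nbrs W G v).card ≤ 3) (hr₀ : Reach W G h₀ b₀) (hq₀ : Quiet W G h₀)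
    (hm : (memory h₀).2 = false) (ht : IsTop W G h₀ w) (hn : NeedsAdvice h₀ (item W G w))
    (h3 : ∀ x ∈ nbrs W G w, curDeg h₀ (item W G x) = 3)
    (hr : Reach W G ((item W G w, true) :: h₀) b) (hb : b = b₀ + 1) (ha : Account W G h₀ b₀) :
    Account W G ((item W G w, true) :: h₀) b := by
  have hq := quiet_of_start hG hdeg hr₀ hq₀ ht hn h3
  have hwU := mem_unproc.1 ht.1
  obtain ⟨hdis, hc3⟩ := nbrs_of_curDeg_eq_three hdeg hwU.1 (curDeg_of_kind_degThree hn.1)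
  have hunseen : ∀ x ∈ W, curDeg h₀ (item W G x) = 3 → x ∉ seen h₀ := fun x hxW hx hxS => by
    obtain ⟨hd, -⟩ := nbrs_of_curDeg_eq_three hdeg hxW hx
    obtain ⟨r, hr⟩ := (hr₀.mem_seen_iff hG).1 hxS
    obtain ⟨hr1, hr2⟩ := Finset.mem_inter.1 hr
    exact Finset.disjoint_left.1 hd hr1 hr2
  have hNS : ∀ x ∈ nbrs W G w, x ∉ seen h₀ := fun x hx =>
    hunseen x (nbrs_subset W G w hx) (h3 x hx)
  have hNU : ∀ x ∈ nbrs W G w, x ∈ unproc W h₀ := fun x hx =>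
    mem_unproc.2 ⟨nbrs_subset W G w hx, Finset.disjoint_left.1 hdis hx⟩
  obtain ⟨hM, hle⟩ := ha.mark hG hdeg hq₀ hm ht hn.1 (by
    rintro ⟨x, hx⟩
    exact hNS x (Finset.mem_inter.1 hx).1 (Finset.mem_inter.1 hx).2)
  have hsuf : h₀ <:+ (item W G w, true) :: h₀ := List.suffix_cons _ _
  have hsh := shrink_of_quiet hG hdeg hr₀ hr hsuf hq₀ hq hM
  have hN : nbrs W G w ∩ unproc W h₀ = nbrs W G w := Finset.inter_eq_left.2 hNU
  obtain ⟨x, y, z, hxy, hxz, hyz, he⟩ := Finset.card_eq_three.1 hc3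
  -- The loss of 36 and a debt of 10 make up the 46 for this bit; the backing vertices are the
  -- neighbors of `w`, the only seen vertices that are unmarked.
  have hg := hsh.gain_star (w := w) (Finset.mem_sdiff.2 ⟨ht.1, by simp [unproc]⟩)
    (hunseen w hwU.1 (curDeg_of_kind_degThree hn.1)) (hN.trans he) hxy hxz hyz
  have hK : unmarked W ((item W G w, true) :: h₀) (unproc W h₀ ∩ seen h₀) = nbrs W G w := by
    ext u
    simp only [unmarked, unproc, Finset.mem_sdiff, Finset.mem_inter, processed_cons,
      Finset.mem_insert, seen_cons, Finset.mem_union]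
    constructor
    · tauto
    · intro hu
      have h5 := hNS u hu
      have h6 := mem_unproc.1 (hNU u hu)
      have h7 : u ≠ w := fun e => notMem_nbrs_self (W := W) (G := G) hG (by rw [e] at hu; exact hu)
      tauto
  refine ⟨_, 10, hM.of_suffix hG hr₀ hr hsuf hq, Or.inr ⟨item W G w, ?_, ?_, Or.inl ⟨rfl, ?_⟩⟩,
    by omega⟩
  · rw [memory_fst_cons_degThree hn.1, if_pos ⟨rfl, hn.2⟩]
    simp
  · rw [hK]
  · rw [hK, hc3]

/-- The number of bits read before the cycles are processed. -/
def PreInv (W : Finset L) (G : SimpleGraph L) (h : History L) (b : ℕ) : Prop :=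
  b = 0 ∨ (Quiet W G h ∧ Account W G h b) ∨ ∃ h₀ b₀ w d₀, Reach W G h₀ b₀ ∧ Account W G h₀ b₀ ∧
    Segment W G h₀ w d₀ h ∧ (NeedsAdvice h₀ (item W G w) → b = b₀ + 1) ∧
    (¬ NeedsAdvice h₀ (item W G w) → b = b₀) ∧
    (NeedsAdvice h₀ (item W G w) → d₀ = true → ∃ x ∈ nbrs W G w, curDeg h₀ (item W G x) ≠ 3)

/-- The account is balanced only at quiet histories; in between, the invariant remembers where the
current segment began. -/
theorem PreInv.account (hG : ∀ u v, G.Adj u v → u ∈ W ∧ v ∈ W)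
    (hdeg : ∀ v ∈ W, (nbrs W G v).card ≤ 3) (hr : Reach W G h b) (hq : Quiet W G h)
    (hex : ∃ T, OptExt W G h T) (hi : PreInv W G h b) : Account W G h b := by
  rcases hi with rfl | ⟨-, ha⟩ | ⟨h₀, b₀, w, d₀, hr₀, ha, hs, hb, hb', hst⟩
  · exact account_zero W G h
  · exact ha
  · exact hs.account hG hdeg hr₀ hr hq hex ha hb hb' hst

theorem HasRej.cons {p : Item L × Bool} (hv : HasRej W G h v) : HasRej W G (p :: h) v := by
  obtain ⟨u, hu⟩ := hv
  obtain ⟨h1, h2⟩ := Finset.mem_inter.1 hu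
  exact ⟨u, Finset.mem_inter.2 ⟨h1, rejected_mono (List.suffix_cons _ _) h2⟩⟩

/-- A vertex of degree three closes the current segment and opens a new one, unless it is accepted
on advice and forces nothing, in which case the debt is booked at once. Other vertices prolong the
segment, and those accepted among them have a rejected neighbor. -/
theorem PreInv.step (hG : ∀ u v, G.Adj u v → u ∈ W ∧ v ∈ W)
    (hdeg : ∀ v ∈ W, (nbrs W G v).card ≤ 3) (hr : Reach W G h b) (hm : (memory h).2 = false)
    (hex : ∃ T, OptExt W G h T) (hi : PreInv W G h b) (ht : IsTop W G h v)
    (hk : kind h (item W G v) ≠ .degTwo) {b' : ℕ} (hr' : Reach W G ((item W G v, d) :: h) b')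
    (hb : NeedsAdvice h (item W G v) → b' = b + 1)
    (hb' : ¬ NeedsAdvice h (item W G v) → b' = b ∧ decideItem h (item W G v) = .answer d) :
    PreInv W G ((item W G v, d) :: h) b' := by
  by_cases hk3 : kind h (item W G v) = .degThree
  · have hq := ht.quiet hdeg hm (Or.inl hk3)
    have ha := hi.account hG hdeg hr hq hex
    by_cases hst : NeedsAdvice h (item W G v) → d = true →
        ∃ x ∈ nbrs W G v, curDeg h (item W G x) ≠ 3
    · refine Or.inr (Or.inr ⟨h, b, v, d, hr, ha, ⟨hq, hm, ht, hk3, List.suffix_rfl,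
        List.Subset.refl _, fun x hx hxp hxv => ?_⟩, hb, fun h' => (hb' h').1, hst⟩)
      exact absurd (accepted_subset_processed _ hx) (by simp [hxp, hxv])
    · push Not at hst
      obtain ⟨hn, rfl, h3⟩ := hst
      exact Or.inr (Or.inl ⟨quiet_of_start hG hdeg hr hq ht hn h3,
        account_of_start hG hdeg hr hq hm ht hn h3 hr' (hb hn) ha⟩)
  · have hn : ¬ NeedsAdvice h (item W G v) := fun hn => hk3 hn.1
    obtain ⟨rfl, hd⟩ := hb' hn
    rcases hi with rfl | ⟨hq, -⟩ | ⟨h₀, b₀, w, d₀, hr₀, ha, hs, h1, h2, h3⟩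
    · exact Or.inl rfl
    · rcases hq.kind_low hm ht.1 with h' | h'
      · exact absurd h' hk3
      · exact absurd h' hk
    · refine Or.inr (Or.inr ⟨h₀, b₀, w, d₀, hr₀, ha, ⟨hs.quiet, hs.memory_snd, hs.top, hs.kind_eq,
        hs.suffix.trans (List.suffix_cons _ _),
        List.Subset.trans hs.memory_subset (memory_fst_subset_cons _ _), fun x hx hxp hxw => ?_⟩,
        h1, h2, h3⟩)
      cases d
      · rw [accepted_cons_false] at hx
        exact (hs.hasRej x hx hxp hxw).cons
      · rw [accepted_cons_true] at hx
        rcases Finset.mem_insert.1 hx with rfl | hx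
        · refine HasRej.cons (p := (item W G x, true)) (h := h) ?_
          have hkk := kind_pre hm (item W G x)
          split_ifs at hkk with c1 c2 c3 c4 c5
          · exact c1
          · simp [decideItem, hkk] at hd
          · simp [decideItem, hkk] at hd
          · simp [decideItem, hkk] at hd
          · exact absurd hkk hk3
          · exact absurd hkk hk
        · exact (hs.hasRej x hx hxp hxw).cons

/-- The invariants before the cycles are processed. -/
theorem Reach.preInv (hG : ∀ u v, G.Adj u v → u ∈ W ∧ v ∈ W)
    (hdeg : ∀ v ∈ W, (nbrs W G v).card ≤ 3) (hr : Reach W G h b) (hm : (memory h).2 = false) :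
    (∃ T, OptExt W G h T) ∧ AdvInv W G h ∧ PreInv W G h b := by
  induction hr with
  | nil =>
    refine ⟨?_, fun p hp => by simp [memory] at hp, Or.inl rfl⟩
    classical
    obtain ⟨T, hT, hmin⟩ := Finset.exists_min_image
      (W.powerset.filter fun T : Finset L => G.IsVertexCover (T : Set L)) Finset.card
      ⟨W, by
        simp only [Finset.mem_filter, Finset.mem_powerset, subset_rfl, true_and]
        exact fun u v huv => Or.inl (hG _ _ huv).1⟩
    simp only [Finset.mem_filter, Finset.mem_powerset] at hT hmin
    exact ⟨T, ⟨hT, fun T' h1 h2 => hmin T' ⟨h1, h2⟩⟩, by simp⟩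
  | @advised h b v d hr ht hn hd ih =>
    have hm' : (memory h).2 = false := by
      by_contra hc
      rw [memory_snd_cons_of_true (by simpa using hc)] at hm
      simp at hm
    have hk : kind h (item W G v) ≠ .degTwo := by rw [hn.1]; simp
    obtain ⟨h1, h2, h3⟩ := ih hm'
    obtain ⟨h4, h5⟩ := step_advised hG hdeg h1 h2 ht.1 hn hd
    exact ⟨h4, h5, h3.step hG hdeg hr hm' h1 ht hk (Reach.advised hr ht hn hd) (fun _ => rfl)
      (fun h' => absurd hn h')⟩
  | @unadvised h b v d hr ht hn hd ih =>
    have hm' : (memory h).2 = false := by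
      by_contra hc
      rw [memory_snd_cons_of_true (by simpa using hc)] at hm
      simp at hm
    have hk : kind h (item W G v) ≠ .degTwo := fun hk => by
      rw [memory_snd_cons_degTwo hk] at hm
      simp at hm
    obtain ⟨h1, h2, h3⟩ := ih hm'
    obtain ⟨h4, h5⟩ := step_unadvised hG hm' h1 h2 ht.1 hn hk hd
    exact ⟨h4, h5, h3.step hG hdeg hr hm' h1 ht hk (Reach.unadvised hr ht hn hd)
      (fun h' => absurd h' hn) (fun _ => ⟨rfl, hd⟩)⟩

end Pre

/-! ### The cycles -/

section Cycles

variable {L : Type*} [DecidableEq L] {W : Finset L} {G : SimpleGraph L} {h h₀ : History L}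
  {b b₀ : ℕ} {v w : L}

theorem Reach.disjoint (hr : Reach W G h b) : Disjoint (accepted h) (rejected h) := by
  have key : ∀ {h : History L} {v : L} {d : Bool}, v ∈ unproc W h →
      Disjoint (accepted h) (rejected h) →
      Disjoint (accepted ((item W G v, d) :: h)) (rejected ((item W G v, d) :: h)) := by
    intro h v d hv hd
    have hv := (mem_unproc.1 hv).2
    cases d
    · simp only [accepted_cons_false, rejected_cons_false, Finset.disjoint_insert_right]
      exact ⟨fun h' => hv (accepted_subset_processed h h'), hd⟩
    · simp only [accepted_cons_true, rejected_cons_true, Finset.disjoint_insert_left]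
      exact ⟨fun h' => hv (rejected_subset_processed h h'), hd⟩
  induction hr with
  | nil => simp
  | advised hr ht hn hd ih => exact key ht.1 ih
  | unadvised hr ht hn hd ih => exact key ht.1 ih

theorem Reach.optExt_iff (hr : Reach W G h b) {T : Finset L} :
    OptExt W G h T ↔ IsMinVertexCover W G T ∧ ∀ v ∈ processed h, (v ∈ T ↔ v ∈ accepted h) := by
  refine and_congr_right fun _ => ⟨fun hT v hv => ?_, fun hT p hp => ?_⟩
  · obtain ⟨p, hp, rfl⟩ := VC.mem_processed.1 hv
    rw [hT p hp]
    refine ⟨fun hd => mem_accepted.2 ⟨p, hp, rfl, hd⟩, fun ha => ?_⟩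
    obtain ⟨q, hq, he, hd⟩ := mem_accepted.1 ha
    rw [← hT p hp, ← he, hT q hq, hd]
  · rw [hT _ (VC.mem_processed.2 ⟨p, hp, rfl⟩)]
    cases hd : p.2
    · have h1 : p.1.1 ∈ rejected h := mem_rejected.2 ⟨p, hp, rfl, hd⟩
      simpa using fun h2 => Finset.disjoint_left.1 hr.disjoint h2 h1
    · have h1 : p.1.1 ∈ accepted h := mem_accepted.2 ⟨p, hp, rfl, hd⟩
      simpa using h1

/-- The unprocessed vertices form cycles, and the accepted ones belong to a minimum cover. -/
def CycleUnion (W : Finset L) (G : SimpleGraph L) (h : History L) : Prop :=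
  (∃ T, OptExt W G h T) ∧ ∀ u ∈ unproc W h, ¬ HasRej W G h u ∧ curDeg h (item W G u) = 2

/-- The vertices that have been processed between `h₀` and `h`. -/
abbrev between (h₀ h : History L) : Finset L := processed h \ processed h₀

/-- Half of the vertices of a cycle are needed in a cover. -/
theorem card_le_of_closed (hG : ∀ u v, G.Adj u v → u ∈ W ∧ v ∈ W) {C T : Finset L}
    (hT : G.IsVertexCover (T : Set L)) (hC : ∀ u ∈ C, (nbrs W G u ∩ C).card = 2) :
    C.card ≤ 2 * (C ∩ T).card := by
  classical
  have h1 : (C \ T).card * 2 ≤ (C ∩ T).card * 2 := by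
    -- Double counting of edges: a vertex outside the cover has both of its neighbors in it, and a
    -- vertex of the cover has at most two outside.
    refine Finset.card_mul_le_card_mul (fun u t => t ∈ nbrs W G u) (fun u hu => ?_) (fun t ht => ?_)
    · obtain ⟨hu1, hu2⟩ := Finset.mem_sdiff.1 hu
      rw [← hC u hu1]
      refine Finset.card_le_card fun t ht => ?_
      obtain ⟨ht1, ht2⟩ := Finset.mem_inter.1 ht
      refine Finset.mem_filter.2 ⟨Finset.mem_inter.2 ⟨ht2, ?_⟩, ht1⟩
      exact (hT ((mem_nbrs hG).1 ht1)).resolve_left hu2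
    · rw [← hC t (Finset.mem_inter.1 ht).1]
      refine Finset.card_le_card fun u hu => ?_
      obtain ⟨hu1, hu2⟩ := Finset.mem_filter.1 hu
      exact Finset.mem_inter.2 ⟨(mem_nbrs_comm hG).1 hu2, (Finset.mem_sdiff.1 hu1).1⟩
  have h2 := Finset.card_sdiff_add_card_inter C T
  omega

/-- The decisions made along a whole cycle are optimal. -/
theorem exists_optExt_of_closed (hG : ∀ u v, G.Adj u v → u ∈ W ∧ v ∈ W) (hr₀ : Reach W G h₀ b₀)
    (hr : Reach W G h b) (hl : h₀ <:+ h) (hc : CycleUnion W G h₀)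
    (hclosed : ∀ u ∈ unproc W h, Disjoint (nbrs W G u) (between h₀ h))
    (hind : ∀ u ∈ between h₀ h, u ∈ rejected h → ∀ v ∈ nbrs W G u, v ∉ rejected h)
    (hcard : 2 * (accepted h ∩ between h₀ h).card ≤ (between h₀ h).card + 1) :
    ∃ T, OptExt W G h T := by
  obtain ⟨⟨T, hT⟩, hc⟩ := hc
  set C := between h₀ h with hCdef
  have hCU : ∀ u ∈ C, u ∈ unproc W h₀ := fun u hu =>
    mem_unproc.2 ⟨hr.processed_subset (Finset.mem_sdiff.1 hu).1, (Finset.mem_sdiff.1 hu).2⟩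
  have hnb : ∀ u ∈ C, ∀ v ∈ nbrs W G u, v ∈ C ∨ v ∈ accepted h₀ := by
    intro u hu v hv
    by_cases hvp : v ∈ processed h₀
    · right
      rw [processed_eq] at hvp
      refine (Finset.mem_union.1 hvp).resolve_right fun hvr => ?_
      exact (hc u (hCU u hu)).1 ⟨v, Finset.mem_inter.2 ⟨hv, hvr⟩⟩
    · left
      refine Finset.mem_sdiff.2 ⟨?_, hvp⟩
      by_contra hvp'
      exact Finset.disjoint_left.1
        (hclosed v (mem_unproc.2 ⟨nbrs_subset W G u hv, hvp'⟩)) ((mem_nbrs_comm hG).1 hv) hu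
  have hreg : ∀ u ∈ C, (nbrs W G u ∩ C).card = 2 := by
    intro u hu
    rw [← (hc u (hCU u hu)).2]
    change _ = (nbrs W G u \ processed h₀).card
    congr 1
    ext v
    simp only [Finset.mem_inter, Finset.mem_sdiff]
    refine and_congr_right fun hv => ⟨fun h' => (Finset.mem_sdiff.1 h').2, fun h' => ?_⟩
    exact (hnb u hu v hv).resolve_right fun h'' => h' (accepted_subset_processed h₀ h'')
  have hhalf := card_le_of_closed hG hT.1.1.2 hreg
  -- The old cover is kept outside of `C` and replaced on `C` by the decisions. It is no larger, as
  -- `2 * (accepted h ∩ C).card ≤ C.card + 1` and `C.card ≤ 2 * (C ∩ T).card`.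
  refine ⟨(T \ C) ∪ (accepted h ∩ C), hr.optExt_iff.2 ⟨⟨⟨?_, ?_⟩, fun T' h1 h2 => ?_⟩, ?_⟩⟩
  · intro u hu
    rcases Finset.mem_union.1 hu with hu | hu
    · exact hT.1.1.1 (Finset.mem_sdiff.1 hu).1
    · exact (mem_unproc.1 (hCU u (Finset.mem_inter.1 hu).2)).1
  · have key : ∀ u v, G.Adj u v → u ∈ C → u ∈ (T \ C) ∪ (accepted h ∩ C) ∨
        v ∈ (T \ C) ∪ (accepted h ∩ C) := by
      intro u v huv hu
      by_cases hua : u ∈ accepted h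
      · exact Or.inl (Finset.mem_union_right _ (Finset.mem_inter.2 ⟨hua, hu⟩))
      have hvn := (mem_nbrs hG (W := W)).2 huv
      have hur : u ∈ rejected h := by
        have := (Finset.mem_sdiff.1 hu).1
        rw [processed_eq] at this
        exact (Finset.mem_union.1 this).resolve_left hua
      right
      by_cases hv : v ∈ C
      · have hvp := (Finset.mem_sdiff.1 hv).1
        rw [processed_eq] at hvp
        exact Finset.mem_union_right _ (Finset.mem_inter.2
          ⟨(Finset.mem_union.1 hvp).resolve_right (hind u hu hur v hvn), hv⟩)
      · exact Finset.mem_union_left _ (Finset.mem_sdiff.2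
          ⟨hT.accepted_subset ((hnb u hu v hvn).resolve_left hv), hv⟩)
    intro u v huv
    by_cases hu : u ∈ C
    · exact key u v huv hu
    by_cases hv : v ∈ C
    · exact (key v u huv.symm hv).symm
    rcases hT.cover huv with h' | h'
    · exact Or.inl (Finset.mem_union_left _ (Finset.mem_sdiff.2 ⟨h', hu⟩))
    · exact Or.inr (Finset.mem_union_left _ (Finset.mem_sdiff.2 ⟨h', hv⟩))
  · refine le_trans ?_ (hT.1.2 T' h1 h2)
    have h3 := Finset.card_union_le (T \ C) (accepted h ∩ C)
    have h4 := Finset.card_sdiff_add_card_inter T C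
    rw [Finset.inter_comm T C] at h4
    omega
  · intro u hu
    by_cases huC : u ∈ C
    · simp [huC]
    · have hu0 : u ∈ processed h₀ := by
        by_contra h'
        exact huC (Finset.mem_sdiff.2 ⟨hu, h'⟩)
      have h1 := (hr₀.optExt_iff.1 hT).2 u hu0
      have h2 : u ∈ accepted h ↔ u ∈ accepted h₀ := by
        refine ⟨fun h' => ?_, fun h' => accepted_mono hl h'⟩
        rw [processed_eq] at hu0
        refine (Finset.mem_union.1 hu0).resolve_right fun h'' => ?_
        exact Finset.disjoint_left.1 hr.disjoint h' (rejected_mono hl h'')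
      simp [huC, h1, h2]

/-- The vertices of a cycle are being processed since `h₀`: the remaining vertices of the
cycle form a path from `y` to `z`, where `z` is adjacent to the vertex `x` processed last, on which
the decision was `d`. -/
structure OnCycle (W : Finset L) (G : SimpleGraph L) (h₀ : History L) (x : L) (d : Bool) (y z : L)
    (h : History L) : Prop where
  reach : ∃ b₀, Reach W G h₀ b₀
  suffix : h₀ <:+ h
  union : CycleUnion W G h₀
  last : ∃ h', h = (item W G x, d) :: h'
  mem_y : y ∈ unproc W h
  mem_z : z ∈ unproc W h
  card_eq : ∀ u ∈ unproc W h, (nbrs W G u ∩ between h₀ h).card =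
    (if u = y then 1 else 0) + (if u = z then 1 else 0)
  z_mem : z ∈ nbrs W G x
  eq_z : ∀ u ∈ nbrs W G x, u ∈ unproc W h → u = z ∨ (u = y ∧ d = false)
  hasRej_y : HasRej W G h y
  hasRej : ∀ u ∈ unproc W h, HasRej W G h u → u = y ∨ (u = z ∧ d = false)
  indep : ∀ u ∈ between h₀ h, u ∈ rejected h → ∀ v ∈ nbrs W G u, v ∉ rejected h
  card_accepted : 2 * (accepted h ∩ between h₀ h).card + (if d = true then 0 else 1) =
    (between h₀ h).card

theorem mem_unproc_cons {p : Item L × Bool} {u : L} :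
    u ∈ unproc W (p :: h) ↔ u ∈ unproc W h ∧ u ≠ p.1.1 := by
  simp only [unproc, processed_cons, Finset.mem_sdiff, Finset.mem_insert]
  tauto

theorem between_cons {p : Item L × Bool} (hp : p.1.1 ∉ processed h₀) :
    between h₀ (p :: h) = insert p.1.1 (between h₀ h) := by
  simp only [between, processed_cons]
  rw [Finset.insert_sdiff_of_notMem _ hp]

/-- The first vertex of a cycle. -/
theorem CycleUnion.onCycle (hG : ∀ u v, G.Adj u v → u ∈ W ∧ v ∈ W) (hr : Reach W G h b)
    (hc : CycleUnion W G h) (hv : v ∈ unproc W h) :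
    ∃ y z, OnCycle W G h v false y z ((item W G v, false) :: h) := by
  have h2 := (hc.2 v hv).2
  rw [← card_inter_unproc] at h2
  obtain ⟨y, z, hyz, he⟩ := Finset.card_eq_two.1 h2
  have hmem : ∀ u, u ∈ nbrs W G v ∩ unproc W h ↔ u = y ∨ u = z := by intro u; rw [he]; simp
  have hy := Finset.mem_inter.1 ((hmem y).2 (Or.inl rfl))
  have hz := Finset.mem_inter.1 ((hmem z).2 (Or.inr rfl))
  have hne : ∀ u ∈ nbrs W G v, u ≠ v := fun u hu e =>
    notMem_nbrs_self (W := W) (G := G) hG (by rw [e] at hu; exact hu)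
  have hvp := (mem_unproc.1 hv).2
  have hbt : between h ((item W G v, false) :: h) = {v} := by
    rw [between_cons hvp]; simp
  refine ⟨y, z, ⟨⟨b, hr⟩, List.suffix_cons _ _, hc, ⟨h, rfl⟩,
    mem_unproc_cons.2 ⟨hy.2, hne y hy.1⟩, mem_unproc_cons.2 ⟨hz.2, hne z hz.1⟩, ?_, hz.1, ?_,
    ⟨v, ?_⟩, ?_, ?_, ?_⟩⟩
  · intro u hu
    have hu' := (mem_unproc_cons.1 hu).1
    rw [hbt]
    by_cases huv : v ∈ nbrs W G u
    · rw [Finset.inter_singleton_of_mem huv, Finset.card_singleton]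
      rcases (hmem u).1 (Finset.mem_inter.2 ⟨(mem_nbrs_comm hG).1 huv, hu'⟩) with rfl | rfl
      · simp [hyz]
      · simp [hyz.symm]
    · rw [Finset.inter_singleton_of_notMem huv, Finset.card_empty]
      have h1 : u ≠ y := fun e => huv ((mem_nbrs_comm hG).1 (e ▸ hy.1))
      have h3 : u ≠ z := fun e => huv ((mem_nbrs_comm hG).1 (e ▸ hz.1))
      simp [h1, h3]
  · intro u hu huU
    have := (hmem u).1 (Finset.mem_inter.2 ⟨hu, (mem_unproc_cons.1 huU).1⟩)
    tauto
  · exact Finset.mem_inter.2 ⟨(mem_nbrs_comm hG).1 hy.1, by simp⟩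
  · rintro u hu ⟨r, hr'⟩
    obtain ⟨hr1, hr2⟩ := Finset.mem_inter.1 hr'
    have hu' := (mem_unproc_cons.1 hu).1
    rw [rejected_cons_false, Finset.mem_insert] at hr2
    rcases hr2 with rfl | hr2
    · have := (hmem u).1 (Finset.mem_inter.2 ⟨(mem_nbrs_comm hG).1 hr1, hu'⟩)
      tauto
    · exact absurd ⟨r, Finset.mem_inter.2 ⟨hr1, hr2⟩⟩ (hc.2 u hu').1
  · intro u hu _ r hr1 hr2
    rw [hbt, Finset.mem_singleton] at hu
    subst hu
    rw [rejected_cons_false, Finset.mem_insert] at hr2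
    rcases hr2 with e | hr2
    · exact hne r hr1 e
    · exact (hc.2 u hv).1 ⟨r, Finset.mem_inter.2 ⟨hr1, hr2⟩⟩
  · have : accepted ((item W G v, false) :: h) ∩ {v} = ∅ := by
      rw [accepted_cons_false]
      refine Finset.inter_singleton_of_notMem fun h' => hvp (accepted_subset_processed h h')
    rw [hbt, this]
    simp

namespace OnCycle

variable {x y z : L} {d : Bool}

/-- After the first vertex of a cycle, both ends of the remaining path are adjacent to it, and the
ties decide the direction. -/
theorem swap (hG : ∀ u v, G.Adj u v → u ∈ W ∧ v ∈ W) (ho : OnCycle W G h₀ x d y z h)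
    (hy : y ∈ nbrs W G x) (hd : d = false) : OnCycle W G h₀ x d z y h where
  reach := ho.reach
  suffix := ho.suffix
  union := ho.union
  last := ho.last
  mem_y := ho.mem_z
  mem_z := ho.mem_y
  card_eq := fun u hu => by rw [ho.card_eq u hu, add_comm]
  z_mem := hy
  eq_z := fun u hu hu' => by have := ho.eq_z u hu hu'; tauto
  hasRej_y := by
    obtain ⟨h', rfl⟩ := ho.last
    exact ⟨x, Finset.mem_inter.2 ⟨(mem_nbrs_comm hG).1 ho.z_mem, by simp [hd]⟩⟩
  hasRej := fun u hu hu' => by have := ho.hasRej u hu hu'; tauto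
  indep := ho.indep
  card_accepted := ho.card_accepted

variable (ho : OnCycle W G h₀ x d y z h)
include ho

theorem z_notMem : z ∉ processed h₀ := fun h' =>
  (mem_unproc.1 ho.mem_z).2 (processed_mono ho.suffix h')

theorem curDeg_add {u : L} (hu : u ∈ unproc W h) :
    curDeg h (item W G u) + (nbrs W G u ∩ between h₀ h).card = 2 := by
  rw [← (ho.union.2 u (unproc_anti ho.suffix hu)).2]
  change (nbrs W G u \ processed h).card + _ = (nbrs W G u \ processed h₀).card
  rw [← Finset.card_union_of_disjoint]
  · congr 1
    ext r
    have : r ∈ processed h₀ → r ∈ processed h := fun h' => processed_mono ho.suffix h'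
    simp only [between, Finset.mem_union, Finset.mem_sdiff, Finset.mem_inter]
    tauto
  · refine Finset.disjoint_left.2 fun r hr1 hr2 => (Finset.mem_sdiff.1 hr1).2 ?_
    exact (Finset.mem_sdiff.1 (Finset.mem_inter.1 hr2).2).1

theorem curDeg_z : curDeg h (item W G z) = if y = z then 0 else 1 := by
  have h1 := ho.curDeg_add ho.mem_z
  rw [ho.card_eq z ho.mem_z] at h1
  by_cases hyz : y = z
  · simp [hyz] at h1 ⊢; omega
  · simp [hyz, Ne.symm hyz] at h1 ⊢; omega

theorem lastRejected_eq : lastRejected h = !d := by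
  obtain ⟨h', rfl⟩ := ho.last
  rfl

/-- The last vertex of a cycle. -/
theorem finish (hG : ∀ u v, G.Adj u v → u ∈ W ∧ v ∈ W) (hyz : y = z)
    (hr : Reach W G ((item W G z, true) :: h) b) :
    CycleUnion W G ((item W G z, true) :: h) ∧
      ∀ u ∈ unproc W ((item W G z, true) :: h), u ∉ nbrs W G z := by
  obtain ⟨b₀, hr₀⟩ := ho.reach
  have hsuf := ho.suffix.trans (List.suffix_cons (item W G z, true) h)
  have hz0 : nbrs W G z \ processed h = ∅ := by
    have h1 := ho.curDeg_z
    rw [if_pos hyz] at h1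
    exact Finset.card_eq_zero.1 h1
  have hzn : ∀ u ∈ unproc W h, u ∉ nbrs W G z := fun u hu hu' => by
    have : u ∈ nbrs W G z \ processed h := Finset.mem_sdiff.2 ⟨hu', (mem_unproc.1 hu).2⟩
    rw [hz0] at this
    simp at this
  have hbt : between h₀ ((item W G z, true) :: h) = insert z (between h₀ h) :=
    between_cons ho.z_notMem
  have hzC : z ∉ between h₀ h := fun h' =>
    (mem_unproc.1 ho.mem_z).2 (Finset.mem_sdiff.1 h').1
  have hno : ∀ u ∈ unproc W ((item W G z, true) :: h), nbrs W G u ∩ between h₀ h = ∅ := by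
    intro u hu
    obtain ⟨hu1, hu2⟩ := mem_unproc_cons.1 hu
    have h1 := ho.card_eq u hu1
    rw [hyz, if_neg hu2] at h1
    exact Finset.card_eq_zero.1 h1
  refine ⟨⟨exists_optExt_of_closed hG hr₀ hr hsuf ho.union ?_ ?_ ?_, ?_⟩, ?_⟩
  · intro u hu
    rw [hbt, Finset.disjoint_insert_right, Finset.disjoint_iff_inter_eq_empty]
    refine ⟨fun h' => hzn u (mem_unproc_cons.1 hu).1 ((mem_nbrs_comm hG).1 h'), hno u hu⟩
  · intro u hu hur r hr1
    rw [rejected_cons_true] at hur ⊢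
    rw [hbt] at hu
    rcases Finset.mem_insert.1 hu with rfl | hu
    · exact absurd (rejected_subset_processed h hur) (mem_unproc.1 ho.mem_z).2
    · exact ho.indep u hu hur r hr1
  · have h1 := ho.card_accepted
    rw [hbt, accepted_cons_true]
    change 2 * (insert z (accepted h) ∩ insert z (between h₀ h)).card ≤ _
    rw [← Finset.insert_inter_distrib, Finset.card_insert_of_notMem hzC]
    have h2 := Finset.card_insert_le z (accepted h ∩ between h₀ h)
    split_ifs at h1 <;> omega
  · intro u hu
    obtain ⟨hu1, hu2⟩ := mem_unproc_cons.1 hu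
    have hu2 : u ≠ z := hu2
    refine ⟨fun hu3 => ?_, ?_⟩
    · have hu3 : HasRej W G h u := by simpa [HasRej] using hu3
      have := ho.hasRej u hu1 hu3
      rw [hyz] at this
      tauto
    · have h1 := ho.curDeg_add hu1
      rw [hno u hu, Finset.card_empty] at h1
      have h2 : nbrs W G u \ processed ((item W G z, true) :: h) = nbrs W G u \ processed h := by
        ext r
        simp only [processed_cons, Finset.mem_sdiff, Finset.mem_insert]
        refine and_congr_right fun hr' => ?_
        have : r ≠ z := fun e => hzn u hu1 ((mem_nbrs_comm hG).1 (e ▸ hr'))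
        tauto
      change (nbrs W G u \ processed ((item W G z, true) :: h)).card = 2
      rw [h2]
      exact h1
  · exact fun u hu => hzn u (mem_unproc_cons.1 hu).1

/-- A further vertex of a cycle, not the last one. -/
theorem next (hG : ∀ u v, G.Adj u v → u ∈ W ∧ v ∈ W) (hyz : y ≠ z) :
    ∃ z', OnCycle W G h₀ z (!d) y z' ((item W G z, !d) :: h) := by
  have hsuf := ho.suffix.trans (List.suffix_cons (item W G z, !d) h)
  have hc1 := ho.curDeg_z
  rw [if_neg hyz] at hc1
  obtain ⟨z', he⟩ := Finset.card_eq_one.1 hc1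
  have hmem : ∀ u ∈ unproc W h, u ∈ nbrs W G z ↔ u = z' := by
    intro u hu
    have hup := (mem_unproc.1 hu).2
    have : u ∈ nbrs W G z \ processed h ↔ u = z' := by
      change u ∈ (item W G z).2 \ processed h ↔ u = z'
      rw [he]; simp
    rw [← this, Finset.mem_sdiff]
    tauto
  have hz'N : z' ∈ nbrs W G z \ processed h := by
    change z' ∈ (item W G z).2 \ processed h
    rw [he]; simp
  obtain ⟨hz'1, hz'2⟩ := Finset.mem_sdiff.1 hz'N
  have hz'U : z' ∈ unproc W h := mem_unproc.2 ⟨nbrs_subset W G z hz'1, hz'2⟩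
  have hz'z : z' ≠ z := fun e =>
    notMem_nbrs_self (W := W) (G := G) hG (by rw [e] at hz'1; exact hz'1)
  have hzp := (mem_unproc.1 ho.mem_z).2
  have hbt : between h₀ ((item W G z, !d) :: h) = insert z (between h₀ h) :=
    between_cons ho.z_notMem
  have hzC : z ∉ between h₀ h := fun h' => hzp (Finset.mem_sdiff.1 h').1
  refine ⟨z', ⟨ho.reach, hsuf, ho.union, ⟨h, rfl⟩, mem_unproc_cons.2 ⟨ho.mem_y, hyz⟩,
    mem_unproc_cons.2 ⟨hz'U, hz'z⟩, ?_, hz'1, ?_, ho.hasRej_y.cons, ?_, ?_, ?_⟩⟩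
  · intro u hu
    obtain ⟨hu1, hu2⟩ := mem_unproc_cons.1 hu
    have hu2 : u ≠ z := hu2
    have h1 := ho.card_eq u hu1
    rw [if_neg hu2, add_zero] at h1
    rw [hbt, ← h1]
    by_cases huz : z ∈ nbrs W G u
    · rw [Finset.inter_insert_of_mem huz, Finset.card_insert_of_notMem
        (fun h' => hzC (Finset.mem_inter.1 h').2),
        if_pos ((hmem u hu1).1 ((mem_nbrs_comm hG).1 huz))]
    · rw [Finset.inter_insert_of_notMem huz,
        if_neg (fun e => huz ((mem_nbrs_comm hG).1 ((hmem u hu1).2 e))), add_zero]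
  · intro u hu hu'
    exact Or.inl ((hmem u (mem_unproc_cons.1 hu').1).1 hu)
  · rintro u hu ⟨r, hr⟩
    obtain ⟨hr1, hr2⟩ := Finset.mem_inter.1 hr
    obtain ⟨hu1, hu2⟩ := mem_unproc_cons.1 hu
    have hu2 : u ≠ z := hu2
    have hold : r ∈ rejected h → u = y := fun hr3 => by
      have := ho.hasRej u hu1 ⟨r, Finset.mem_inter.2 ⟨hr1, hr3⟩⟩
      tauto
    cases d
    · simp only [Bool.not_false, rejected_cons_true] at hr2
      exact Or.inl (hold hr2)
    · simp only [Bool.not_true, rejected_cons_false, Finset.mem_insert] at hr2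
      rcases hr2 with rfl | hr2
      · exact Or.inr ⟨(hmem u hu1).1 ((mem_nbrs_comm hG).1 hr1), rfl⟩
      · exact Or.inl (hold hr2)
  · have hind : ∀ u ∈ insert z (between h₀ h), u ∈ rejected h → ∀ v ∈ nbrs W G u,
        v ∉ rejected h := by
      intro u hu hur
      rcases Finset.mem_insert.1 hu with rfl | hu
      · exact absurd (rejected_subset_processed h hur) hzp
      · exact ho.indep u hu hur
    rw [hbt]
    cases d
    · simpa using hind
    · have hzr : ¬ HasRej W G h z := fun h' => by
        have := ho.hasRej z ho.mem_z h'
        simp [Ne.symm hyz] at this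
      have hzr' : ∀ r ∈ nbrs W G z, r ∉ rejected h := fun r hr1 hr2 =>
        hzr ⟨r, Finset.mem_inter.2 ⟨hr1, hr2⟩⟩
      intro u hu hur r hr1 hr2
      simp only [Bool.not_true, rejected_cons_false, Finset.mem_insert] at hur hr2
      rcases hur with rfl | hur
      · rcases hr2 with rfl | hr2
        · exact notMem_nbrs_self hG hr1
        · exact hzr' r hr1 hr2
      · rcases hr2 with rfl | hr2
        · exact hzr' u ((mem_nbrs_comm hG).1 hr1) hur
        · exact hind u hu hur r hr1 hr2
  · have h1 := ho.card_accepted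
    rw [hbt, Finset.card_insert_of_notMem hzC]
    cases d
    · simp only [Bool.not_false, accepted_cons_true, ← Finset.insert_inter_distrib]
      rw [Finset.card_insert_of_notMem (fun h' => hzC (Finset.mem_inter.1 h').2)]
      simp at h1 ⊢
      omega
    · simp only [Bool.not_true, accepted_cons_false]
      rw [Finset.inter_insert_of_notMem (fun h' => hzp (accepted_subset_processed h h'))]
      simp at h1 ⊢
      omega

end OnCycle

/-- The invariant once the processing of the cycles has begun. -/
def CycleInv (W : Finset L) (G : SimpleGraph L) (h : History L) : Prop :=
  (CycleUnion W G h ∧ ∀ u ∈ unproc W h, adjLast h (item W G u) = false) ∨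
    ∃ h₀ x d y z, OnCycle W G h₀ x d y z h

theorem kind_eq_follow (hdeg : ∀ v ∈ W, (nbrs W G v).card ≤ 3) (hv : v ∈ W)
    (hp : 20 ≤ priorityValue h (item W G v)) : kind h (item W G v) = .follow := by
  have h1 := priorityValue_low (h := h) hdeg hv
  unfold priorityValue at hp
  cases hk : kind h (item W G v) <;> simp only [hk] at hp <;> try omega
  · rfl
  · have := h1 (Or.inl hk)
    rw [priorityValue_degThree hk] at this
    exact absurd (hp.trans this) (by omega)

theorem kind_follow_iff (hm : (memory h).2 = true) {x : Item L} :
    kind h x = .follow ↔ adjLast h x = true := by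
  unfold kind kindWith
  split_ifs <;> simp_all

theorem OnCycle.step {x y z : L} {d e : Bool} (hG : ∀ u v, G.Adj u v → u ∈ W ∧ v ∈ W)
    (hdeg : ∀ v ∈ W, (nbrs W G v).card ≤ 3) (ho : OnCycle W G h₀ x d y z h)
    (hm : (memory h).2 = true) (ht : IsTop W G h v)
    (hd : decideItem h (item W G v) = .answer e) (hr : Reach W G ((item W G v, e) :: h) b) :
    CycleInv W G ((item W G v, e) :: h) := by
  have hadj : ∀ u, adjLast h (item W G u) = true ↔ u ∈ nbrs W G x := fun u => by
    obtain ⟨h', rfl⟩ := ho.last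
    simp [adjLast]
  have hz : kind h (item W G z) = .follow := (kind_follow_iff hm).2 ((hadj z).2 ho.z_mem)
  have hk : kind h (item W G v) = .follow := by
    refine kind_eq_follow hdeg (mem_unproc.1 ht.1).1 ?_
    have := ht.2 z ho.mem_z
    simpa [priorityValue, hz] using this
  have hvx := (hadj v).1 ((kind_follow_iff hm).1 hk)
  have key : ∀ {y z : L}, OnCycle W G h₀ x d y z h → v = z →
      CycleInv W G ((item W G v, e) :: h) := by
    rintro y z ho rfl
    simp only [decideItem, hk, AdviceTree.answer.injEq, ho.curDeg_z, ho.lastRejected_eq] at hd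
    by_cases hyz : y = v
    · simp only [hyz, if_true, decide_true, Bool.or_true] at hd
      subst hd
      obtain ⟨h1, h2⟩ := ho.finish hG hyz hr
      exact Or.inl ⟨h1, fun u hu => by simpa [adjLast] using h2 u hu⟩
    · simp only [hyz, if_false, one_ne_zero, decide_false, Bool.or_false] at hd
      subst hd
      obtain ⟨z', h1⟩ := ho.next hG hyz
      exact Or.inr ⟨_, _, _, _, _, h1⟩
  -- If the cycle is followed in the other direction, the path is reversed.
  rcases ho.eq_z v hvx ht.1 with e | ⟨e, hd'⟩
  · exact key ho e
  · exact key (ho.swap hG (e ▸ hvx) hd') e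

/-- The first vertex of a cycle may also be received under rule 4; it is rejected in either case. -/
theorem CycleUnion.step {e : Bool} (hG : ∀ u v, G.Adj u v → u ∈ W ∧ v ∈ W) (hr : Reach W G h b)
    (hc : CycleUnion W G h)
    (hadj : (memory h).2 = true → adjLast h (item W G v) = false) (hv : v ∈ unproc W h)
    (hd : decideItem h (item W G v) = .answer e) : CycleInv W G ((item W G v, e) :: h) := by
  have he : e = false := by
    obtain ⟨h1, h2⟩ := hc.2 v hv
    have hk : kind h (item W G v) = .sibling ∨ kind h (item W G v) = .degTwo := by
      unfold kind kindWith
      split_ifs with c1 c2 c3 c4 c5 c6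
      · rw [hadj c1.1] at c1
        simp at c1
      · exact absurd c2 h1
      · omega
      · omega
      · exact Or.inl rfl
      · omega
      · exact Or.inr rfl
    rcases hk with hk | hk <;> simp only [decideItem, hk, AdviceTree.answer.injEq] at hd <;>
      exact hd.symm
  subst he
  obtain ⟨y, z, h1⟩ := hc.onCycle hG hr hv
  exact Or.inr ⟨_, _, _, _, _, h1⟩

theorem CycleInv.not_needsAdvice (hc : CycleInv W G h)
    (hv : v ∈ unproc W h) : ¬ NeedsAdvice h (item W G v) := by
  intro hn
  have h3 := curDeg_of_kind_degThree hn.1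
  rcases hc with ⟨⟨-, h1⟩, -⟩ | ⟨h₀, x, d, y, z, ho⟩
  · have := (h1 v hv).2
    omega
  · have := ho.curDeg_add hv
    omega

/-- When a vertex of degree two is received for the first time, there are only cycles left. -/
theorem cycleUnion_of_degTwo (hdeg : ∀ v ∈ W, (nbrs W G v).card ≤ 3) (hm : (memory h).2 = false)
    (hex : ∃ T, OptExt W G h T) (ht : IsTop W G h v) (hk : kind h (item W G v) = .degTwo) :
    CycleUnion W G h := by
  refine ⟨hex, fun u hu => ?_⟩
  have hku := ht.kind_degTwo hk u hu
  obtain ⟨h1, h2, -⟩ := kind_pre_low hm (Or.inr hku)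
  have h3 := curDeg_le (G := G) (h := h) hdeg (mem_unproc.1 hu).1
  refine ⟨h1, ?_⟩
  by_contra hne
  have := (ht.quiet hdeg hm (Or.inr hk)).kind_degThree hm hu (by omega)
  rw [hku] at this
  simp at this

theorem Reach.cycleInv (hG : ∀ u v, G.Adj u v → u ∈ W ∧ v ∈ W)
    (hdeg : ∀ v ∈ W, (nbrs W G v).card ≤ 3) (hr : Reach W G h b) (hm : (memory h).2 = true) :
    46 * b ≤ 15 * W.card ∧ CycleInv W G h := by
  induction hr with
  | nil => simp [memory] at hm
  | @advised h b v d hr ht hn hd ih =>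
    have hk : kind h (item W G v) ≠ .degTwo := by rw [hn.1]; simp
    rw [memory_snd_cons hk] at hm
    exact absurd hn ((ih hm).2.not_needsAdvice ht.1)
  | @unadvised h b v d hr ht hn hd ih =>
    cases hm' : (memory h).2
    · have hk : kind h (item W G v) = .degTwo := by
        by_contra hk
        rw [memory_snd_cons hk, hm'] at hm
        simp at hm
      obtain ⟨h1, -, h2⟩ := hr.preInv hG hdeg hm'
      -- The history is quiet when rule 6 first applies, so the account gives the bound; no bit is
      -- read after that.
      exact ⟨(h2.account hG hdeg hr (ht.quiet hdeg hm' (Or.inr hk)) h1).le,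
        (cycleUnion_of_degTwo hdeg hm' h1 ht hk).step hG hr (by simp [hm']) ht.1 hd⟩
    · obtain ⟨h1, h2⟩ := ih hm'
      refine ⟨h1, ?_⟩
      rcases h2 with ⟨h2, h3⟩ | ⟨h₀, x, d', y, z, ho⟩
      · exact h2.step hG hr (fun _ => h3 v ht.1) ht.1 hd
      · exact ho.step hG hdeg hm' ht hd (Reach.unadvised hr ht hn hd)

/-- When all vertices have been processed, the accepted ones form a minimum cover, and few bits of
advice have been read. -/
theorem Reach.final (hG : ∀ u v, G.Adj u v → u ∈ W ∧ v ∈ W)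
    (hdeg : ∀ v ∈ W, (nbrs W G v).card ≤ 3) (hr : Reach W G h b) (hW : W ⊆ processed h) :
    IsMinVertexCover W G (accepted h) ∧ 46 * b ≤ 15 * W.card := by
  have hU : ∀ u, u ∉ unproc W h := fun u hu => (mem_unproc.1 hu).2 (hW (mem_unproc.1 hu).1)
  have hopt : (∃ T, OptExt W G h T) → IsMinVertexCover W G (accepted h) := by
    rintro ⟨T, hT⟩
    have h1 := (hr.optExt_iff.1 hT).2
    have : T = accepted h := by
      refine Finset.Subset.antisymm (fun u hu => ?_) hT.accepted_subset
      exact (h1 u (hW (hT.1.1.1 hu))).1 hu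
    exact this ▸ hT.1
  cases hm : (memory h).2
  · obtain ⟨h1, -, h2⟩ := hr.preInv hG hdeg hm
    -- With no vertex left, the history is quiet vacuously.
    exact ⟨hopt h1, (h2.account hG hdeg hr (fun u hu => absurd hu (hU u)) h1).le⟩
  · obtain ⟨h1, h2⟩ := hr.cycleInv hG hdeg hm
    refine ⟨hopt ?_, h1⟩
    rcases h2 with ⟨h2, -⟩ | ⟨h₀, x, d, y, z, ho⟩
    · exact h2.1
    · exact absurd ho.mem_y (hU y)

end Cycles

end VC

theorem mainTheorem1 {L : Type*} [DecidableEq L] :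
    (VC.ALG L).IsModel2 ∧
    ∀ (W : Finset L) (G : SimpleGraph L), (∀ u v, G.Adj u v → u ∈ W ∧ v ∈ W) →
      (∀ v ∈ W, (VC.nbrs W G v).card ≤ 3) →
      ∀ τ : VC.History L → List Bool → Multiset (VC.Item L) → VC.Item L,
        (VC.ALG L).IsTieBreaking τ →
        (∃ a : ℕ → Bool, VC.IsOracleTape W G τ a) ∧
        ∀ a : ℕ → Bool, VC.IsOracleTape W G τ a →
          VC.IsMinVertexCover W G
            (VC.accepted ((VC.ALG L).finalConfig τ a (VC.instanceOf W G)).history) ∧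
          ((((VC.ALG L).finalConfig τ a (VC.instanceOf W G)).advice.length : ℕ) : ℝ) ≤
            15 * (W.card : ℝ) / 46 := by
  refine ⟨fun h s s' => rfl, fun W G hG hdeg τ hτ => ⟨VC.exists_isOracleTape W G τ, fun a ha => ?_⟩⟩
  obtain ⟨hr, hW⟩ := VC.finalConfig_spec hτ ha
  obtain ⟨h1, h2⟩ := hr.final hG hdeg hW
  refine ⟨h1, ?_⟩
  have h3 : (46 : ℝ) * (((VC.ALG L).finalConfig τ a (VC.instanceOf W G)).advice.length : ℕ) ≤
      15 * (W.card : ℝ) := by exact_mod_cast h2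
  linarith
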